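/- Let $A$ be an associative ring with identity and let $S\subseteq A$ be a subring containing $1$. For a right $A$-module $N$ and a left $A$-module $M$, let $$\mathrm{Tor}^{(A,S)}_k(N,M)=H_k\bigl(N\otimes_A\beta(A,S,A)\otimes_A M\bigr),\qquad k\ge 0,$$ where $\beta(A,S,A)$ is the complex of $A$-bimodules with terms $\beta_k=A^{\otimes_S(k+1)}\otimes_S A$ for $k\ge 0$ and differentials $d_k=\sum_{j=0}^{k}(-1)^j d_{k,j}\colon\beta_k\to\beta_{k-1}$ for $k\ge 1$, with $d_{k,j}(a_0\otimes\dots\otimes a_{k+1})=a_0\otimes\dots\otimes a_ja_{j+1}\otimes\dots\otimes a_{k+1}$. Let $e\in S$ be an idempotent and write $\bar e=1-e$. Suppose that $S$ is diagonal with respect to $e$, that is, $\bar eSe=eS\bar e=0$. Suppose further that $A$ admits an $LU$-decomposition, that is, there are subrings $L$ and $U$ of $A$, both containing $S$, such that 1. the map $L\otimes_S U\to A$, $l\otimes u\mapsto lu$, is an isomorphism of abelian groups ($(A,S)$ is a twisted product of $L$ and $U$); 2. $L$ is lower triangular: $eL\bar e=0$; 3. $U$ is upper triangular: $\bar eUe=0$.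 Then the ideal $AeA$ is $(A,S)$-stratifying, that is, $$\mathrm{Tor}^{(A,S)}_k(A/AeA,\,A/AeA)=0\qquad\text{for all }k\ge 1.$$ -/

import Mathlib

open MulOpposite CategoryTheory

universe u v w

noncomputable section

/-! ### Tensor products over a noncommutative ring

Right `R`-modules are modules over `Rᵐᵒᵖ`, so `n · r` is written `op r • n`. -/

section RingTensor

variable (R : Type*) [Ring R]

/-- The relations `(n · r) ⊗ m - n ⊗ (r · m)` in `N ⊗_ℤ M`. -/
def ringTensorRel (N M : Type*) [AddCommGroup N] [Module Rᵐᵒᵖ N] [AddCommGroup M] [Module R M] :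
    AddSubgroup (TensorProduct ℤ N M) :=
  AddSubgroup.closure
    {x | ∃ (n : N) (r : R) (m : M),
      x = TensorProduct.tmul ℤ (op r • n) m - TensorProduct.tmul ℤ n (r • m)}

/-- The abelian group `N ⊗_R M` for a right `R`-module `N` and a left `R`-module `M`,
where `R` need not be commutative. -/
def RingTensor (N M : Type*) [AddCommGroup N] [Module Rᵐᵒᵖ N] [AddCommGroup M] [Module R M] :
    Type _ :=
  TensorProduct ℤ N M ⧸ ringTensorRel R N M

namespace RingTensor

variable {N N' N'' M M' M'' : Type*}
  [AddCommGroup N] [Module Rᵐᵒᵖ N] [AddCommGroup N'] [Module Rᵐᵒᵖ N']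
  [AddCommGroup N''] [Module Rᵐᵒᵖ N'']
  [AddCommGroup M] [Module R M] [AddCommGroup M'] [Module R M'] [AddCommGroup M''] [Module R M'']

instance : AddCommGroup (RingTensor R N M) :=
  inferInstanceAs (AddCommGroup (TensorProduct ℤ N M ⧸ ringTensorRel R N M))

/-- The quotient map `N ⊗_ℤ M → N ⊗_R M`. -/
def mk : TensorProduct ℤ N M →+ RingTensor R N M :=
  QuotientAddGroup.mk' (ringTensorRel R N M)

/-- The pure tensor `n ⊗ m`. -/
def tmul (n : N) (m : M) : RingTensor R N M :=
  mk R (TensorProduct.tmul ℤ n m)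

variable {R}

theorem smul_tmul (n : N) (r : R) (m : M) : tmul R (op r • n) m = tmul R n (r • m) := by
  rw [← sub_eq_zero, tmul, tmul, ← map_sub]
  exact (QuotientAddGroup.eq_zero_iff _).2 (AddSubgroup.subset_closure ⟨n, r, m, rfl⟩)

theorem add_tmul (n n' : N) (m : M) : tmul R (n + n') m = tmul R n m + tmul R n' m := by
  rw [tmul, TensorProduct.add_tmul, map_add]; rfl

theorem tmul_add (n : N) (m m' : M) : tmul R n (m + m') = tmul R n m + tmul R n m' := by
  rw [tmul, TensorProduct.tmul_add, map_add]; rfl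

theorem zero_tmul (m : M) : tmul R (0 : N) m = 0 := by
  rw [tmul, TensorProduct.zero_tmul, map_zero]

theorem tmul_zero (n : N) : tmul R n (0 : M) = 0 := by
  rw [tmul, TensorProduct.tmul_zero, map_zero]

theorem induction_on {p : RingTensor R N M → Prop} (x : RingTensor R N M)
    (zero : p 0) (tmul : ∀ n m, p (tmul R n m)) (add : ∀ x y, p x → p y → p (x + y)) : p x := by
  obtain ⟨y, rfl⟩ : ∃ y, mk R y = x := QuotientAddGroup.mk'_surjective (ringTensorRel R N M) x
  induction y using TensorProduct.induction_on with
  | zero => rw [map_zero]; exact zero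
  | tmul n m => exact tmul n m
  | add x y hx hy => rw [map_add]; exact add _ _ hx hy

/-- The universal property: a balanced biadditive map induces a homomorphism on `N ⊗_R M`. -/
def lift {P : Type*} [AddCommGroup P] (f : N →+ M →+ P)
    (hf : ∀ (n : N) (r : R) (m : M), f (op r • n) m = f n (r • m)) : RingTensor R N M →+ P :=
  QuotientAddGroup.lift (ringTensorRel R N M)
    (TensorProduct.liftAddHom f (fun z n m => by simp))
    ((AddSubgroup.closure_le _).2 (by
      rintro _ ⟨n, r, m, rfl⟩
      simp [hf]))

@[simp]
theorem lift_tmul {P : Type*} [AddCommGroup P] (f : N →+ M →+ P)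
    (hf : ∀ (n : N) (r : R) (m : M), f (op r • n) m = f n (r • m)) (n : N) (m : M) :
    lift f hf (tmul R n m) = f n m := rfl

theorem addHom_ext {P : Type*} [AddCommGroup P] {f g : RingTensor R N M →+ P}
    (h : ∀ n m, f (tmul R n m) = g (tmul R n m)) : f = g := by
  ext x
  induction x using induction_on with
  | zero => simp
  | tmul n m => exact h n m
  | add x y hx hy => rw [map_add, map_add, hx, hy]

/-- `f ⊗ g : N ⊗_R M → N' ⊗_R M'`. -/
def map (f : N →ₗ[Rᵐᵒᵖ] N') (g : M →ₗ[R] M') : RingTensor R N M →+ RingTensor R N' M' :=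
  lift
    (AddMonoidHom.mk' (fun n => AddMonoidHom.mk' (fun m => tmul R (f n) (g m))
        (fun m m' => by rw [map_add, tmul_add]))
      (fun n n' => by ext m; simp [add_tmul]))
    (fun n r m => by simp [smul_tmul])

@[simp]
theorem map_tmul (f : N →ₗ[Rᵐᵒᵖ] N') (g : M →ₗ[R] M') (n : N) (m : M) :
    map f g (tmul R n m) = tmul R (f n) (g m) := rfl

/-- If `N` is a `(T, R)`-bimodule, then `N ⊗_R M` is a left `T`-module. -/
instance leftModule {T : Type*} [Ring T] [Module T N] [SMulCommClass T Rᵐᵒᵖ N] :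
    Module T (RingTensor R N M) where
  smul t x := map (DistribSMul.toLinearMap Rᵐᵒᵖ N t) LinearMap.id x
  smul_zero t := map_zero (map (DistribSMul.toLinearMap Rᵐᵒᵖ N t) LinearMap.id)
  smul_add t := map_add (map (DistribSMul.toLinearMap Rᵐᵒᵖ N t) LinearMap.id)
  one_smul x := by
    change map (DistribSMul.toLinearMap Rᵐᵒᵖ N (1 : T)) LinearMap.id x = x
    induction x using induction_on with
    | zero => simp
    | tmul n m => simp
    | add x y hx hy => rw [map_add, hx, hy]
  mul_smul s t x := by
    change map (DistribSMul.toLinearMap Rᵐᵒᵖ N (s * t)) LinearMap.id x =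
      map (DistribSMul.toLinearMap Rᵐᵒᵖ N s) LinearMap.id
        (map (DistribSMul.toLinearMap Rᵐᵒᵖ N t) LinearMap.id x)
    induction x using induction_on with
    | zero => simp
    | tmul n m => simp [mul_smul]
    | add x y hx hy => simp only [map_add, hx, hy]
  add_smul s t x := by
    change map (DistribSMul.toLinearMap Rᵐᵒᵖ N (s + t)) LinearMap.id x =
      map (DistribSMul.toLinearMap Rᵐᵒᵖ N s) LinearMap.id x +
        map (DistribSMul.toLinearMap Rᵐᵒᵖ N t) LinearMap.id x
    induction x using induction_on with
    | zero => simp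
    | tmul n m => simp [add_smul, add_tmul]
    | add x y hx hy => simp only [map_add, hx, hy]; abel
  zero_smul x := by
    change map (DistribSMul.toLinearMap Rᵐᵒᵖ N (0 : T)) LinearMap.id x = 0
    induction x using induction_on with
    | zero => simp
    | tmul n m => simp [zero_tmul]
    | add x y hx hy => rw [map_add, hx, hy, add_zero]

@[simp]
theorem left_smul_tmul {T : Type*} [Ring T] [Module T N] [SMulCommClass T Rᵐᵒᵖ N]
    (t : T) (n : N) (m : M) : t • tmul R n m = tmul R (t • n) m := rfl

/-- If `M` is an `(R, T)`-bimodule, then `N ⊗_R M` is a right `T`-module. -/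
instance rightModule {T : Type*} [Ring T] [Module Tᵐᵒᵖ M] [SMulCommClass R Tᵐᵒᵖ M] :
    Module Tᵐᵒᵖ (RingTensor R N M) :=
  letI : SMulCommClass Tᵐᵒᵖ R M := SMulCommClass.symm _ _ _
  { smul := fun t x => map LinearMap.id (DistribSMul.toLinearMap R M t) x
    smul_zero := fun t => map_zero (map LinearMap.id (DistribSMul.toLinearMap R M t))
    smul_add := fun t => map_add (map LinearMap.id (DistribSMul.toLinearMap R M t))
    one_smul := fun x => by
      change map LinearMap.id (DistribSMul.toLinearMap R M (1 : Tᵐᵒᵖ)) x = x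
      induction x using induction_on with
      | zero => simp
      | tmul n m => simp
      | add x y hx hy => rw [map_add, hx, hy]
    mul_smul := fun s t x => by
      change map LinearMap.id (DistribSMul.toLinearMap R M (s * t)) x =
        map LinearMap.id (DistribSMul.toLinearMap R M s)
          (map LinearMap.id (DistribSMul.toLinearMap R M t) x)
      induction x using induction_on with
      | zero => simp
      | tmul n m => simp [mul_smul]
      | add x y hx hy => simp only [map_add, hx, hy]
    add_smul := fun s t x => by
      change map LinearMap.id (DistribSMul.toLinearMap R M (s + t)) x =
        map LinearMap.id (DistribSMul.toLinearMap R M s) x +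
          map LinearMap.id (DistribSMul.toLinearMap R M t) x
      induction x using induction_on with
      | zero => simp
      | tmul n m => simp [add_smul, tmul_add]
      | add x y hx hy => simp only [map_add, hx, hy]; abel
    zero_smul := fun x => by
      change map LinearMap.id (DistribSMul.toLinearMap R M (0 : Tᵐᵒᵖ)) x = 0
      induction x using induction_on with
      | zero => simp
      | tmul n m => simp [tmul_zero]
      | add x y hx hy => rw [map_add, hx, hy, add_zero] }

/-- A balanced biadditive map that is `T`-linear in the first variable induces a homomorphism of
left `T`-modules on `N ⊗_R M`. -/
def liftLeft {T P : Type*} [Ring T] [Module T N] [SMulCommClass T Rᵐᵒᵖ N]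
    [AddCommGroup P] [Module T P] (f : N →+ M →+ P)
    (hf : ∀ (n : N) (r : R) (m : M), f (op r • n) m = f n (r • m))
    (hT : ∀ (t : T) (n : N) (m : M), f (t • n) m = t • f n m) : RingTensor R N M →ₗ[T] P where
  toFun := lift f hf
  map_add' := map_add _
  map_smul' t x := by
    induction x using induction_on with
    | zero => simp
    | tmul n m => exact hT t n m
    | add x y hx hy => simp only [smul_add, map_add, hx, hy]

/-- `f ⊗ g` as a homomorphism of left `T`-modules, when `f` is also `T`-linear. -/
def mapLeft {T : Type*} [Ring T] [Module T N] [SMulCommClass T Rᵐᵒᵖ N]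
    [Module T N'] [SMulCommClass T Rᵐᵒᵖ N'] (f : N →ₗ[Rᵐᵒᵖ] N') (g : M →ₗ[R] M')
    (hT : ∀ (t : T) (n : N), f (t • n) = t • f n) : RingTensor R N M →ₗ[T] RingTensor R N' M' where
  toFun := map f g
  map_add' := map_add _
  map_smul' t x := by
    induction x using induction_on with
    | zero => simp
    | tmul n m => simp [hT]
    | add x y hx hy => simp only [smul_add, map_add, hx, hy]

theorem right_smul_tmul {T : Type*} [Ring T] [Module Tᵐᵒᵖ M] [SMulCommClass R Tᵐᵒᵖ M]
    (t : T) (n : N) (m : M) :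
    (rightModule (R := R) (N := N) (M := M) (T := T)).toSMul.smul (op t) (tmul R n m) =
      tmul R n (op t • m) := rfl

end RingTensor

end RingTensor

/-! ### Restriction of scalars and quotient modules -/

/-- A right `A`-module is a right module over every subring `S` of `A`. -/
instance subringOpModule {A : Type*} [Ring A] (S : Subring A) (N : Type*) [AddCommGroup N]
    [Module Aᵐᵒᵖ N] : Module (↥S)ᵐᵒᵖ N :=
  Module.compHom N (RingHom.op S.subtype)

theorem subring_op_smul {A : Type*} [Ring A] (S : Subring A) {N : Type*} [AddCommGroup N]
    [Module Aᵐᵒᵖ N] (s : S) (n : N) : op s • n = op (s : A) • n := rfl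

instance subringOpSMulCommClass {A : Type*} [Ring A] (S : Subring A) (N T : Type*)
    [AddCommGroup N] [Module Aᵐᵒᵖ N] [SMul T N] [SMulCommClass T Aᵐᵒᵖ N] :
    SMulCommClass T (↥S)ᵐᵒᵖ N where
  smul_comm t s n := smul_comm t (op ((unop s : S) : A)) n

/-- The right `A`-module structure `[x] · a = [x a]` of the quotient of `A` by a two-sided ideal. -/
instance quotientOpModule {A : Type*} [Ring A] (I : Ideal A) [I.IsTwoSided] :
    Module Aᵐᵒᵖ (A ⧸ I) :=
  Module.compHom (A ⧸ I) (RingHom.op (Ideal.Quotient.mk I))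

theorem quotient_op_smul {A : Type*} [Ring A] (I : Ideal A) [I.IsTwoSided] (a x : A) :
    op a • (Ideal.Quotient.mk I x) = Ideal.Quotient.mk I (x * a) := rfl

/-! ### The bar resolution -/

/-- An `(A, T)`-bimodule: a left `A`-module and right `T`-module with commuting actions. -/
structure RingBimodule (A : Type u) (T : Type v) [Ring A] [Ring T] where
  carrier : Type w
  [addCommGroup : AddCommGroup carrier]
  [leftModule : Module A carrier]
  [rightModule : Module Tᵐᵒᵖ carrier]
  [smulComm : SMulCommClass A Tᵐᵒᵖ carrier]

namespace RingBimodule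

attribute [instance] addCommGroup leftModule rightModule smulComm

instance {A : Type u} {T : Type v} [Ring A] [Ring T] : CoeSort (RingBimodule.{u, v, w} A T) (Type w) :=
  ⟨carrier⟩

end RingBimodule

section Bar

variable {A : Type u} [Ring A] (S : Subring A) {T : Type v} [Ring T]

/-- The `(A, T)`-bimodule `A ⊗_S X`. -/
def barStep (X : RingBimodule.{u, v, u} A T) : RingBimodule.{u, v, u} A T where
  carrier := RingTensor S A X
  leftModule := RingTensor.leftModule
  rightModule := RingTensor.rightModule
  smulComm := ⟨fun a t x => by
    induction x using RingTensor.induction_on with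
    | zero => simp only [smul_zero]
    | tmul n m => rfl
    | add x y hx hy => simp only [smul_add, hx, hy]⟩

/-- The multiplication `A ⊗_S X → X`, `a ⊗ x ↦ a x`. -/
def barAct (X : RingBimodule.{u, v, u} A T) : barStep S X →ₗ[A] X :=
  RingTensor.liftLeft (R := S) (N := A) (M := X) (T := A)
    (AddMonoidHom.mk' (fun a => AddMonoidHom.mk' (fun x : X => a • x) (smul_add a))
      (fun a b => by ext x; exact add_smul a b x))
    (fun a s x => mul_smul a (s : A) x)
    (fun a b x => mul_smul a b x)

/-- The map `id_A ⊗ f : A ⊗_S X → A ⊗_S Y`, `a ⊗ x ↦ a ⊗ f x`. -/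
def barStepMap {X Y : RingBimodule.{u, v, u} A T} (f : X →ₗ[A] Y) :
    barStep S X →ₗ[A] barStep S Y :=
  RingTensor.mapLeft (R := S) (N := A) (N' := A) (M := X) (M' := Y) (T := A) LinearMap.id
    { toFun := f, map_add' := map_add f, map_smul' := fun s x => map_smul f (s : A) x }
    (fun _ _ => rfl)

/-- The terms of the bar resolution with the index shifted by one: `bar S M k` is
`B_{k-1}(A,S,M)`, so `bar S M 0 = M` and `bar S M (k+1) = A ⊗_S (A ⊗_S ⋯ ⊗_S (A ⊗_S M))`
with `k+1` factors `A`. -/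
def bar (M : RingBimodule.{u, v, u} A T) : ℕ → RingBimodule.{u, v, u} A T
  | 0 => M
  | k + 1 => barStep S (bar M k)

/-- The pure tensor `a ⊗ x` in `B_k(A,S,M) = A ⊗_S B_{k-1}(A,S,M)`. -/
def barMk (M : RingBimodule.{u, v, u} A T) (k : ℕ) (a : A) : bar S M k →+ bar S M (k + 1) :=
  AddMonoidHom.mk' (fun x => (RingTensor.tmul S a x : RingTensor S A (bar S M k)))
    (fun x y => RingTensor.tmul_add a x y)

theorem bar_induction {M : RingBimodule.{u, v, u} A T} {k : ℕ} {p : bar S M (k + 1) → Prop}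
    (x : bar S M (k + 1)) (zero : p 0) (mk : ∀ a y, p (barMk S M k a y))
    (add : ∀ x y, p x → p y → p (x + y)) : p x :=
  RingTensor.induction_on (R := S) (N := A) (M := bar S M k) x zero mk add

/-- The face maps `d_{k,j} : B_k(A,S,M) → B_{k-1}(A,S,M)`, `0 ≤ j ≤ k`, which multiply the
neighbouring tensor factors in positions `j` and `j+1`. -/
def barFace (M : RingBimodule.{u, v, u} A T) :
    (k : ℕ) → Fin (k + 1) → (bar S M (k + 1) →ₗ[A] bar S M k)
  | 0, _ => barAct S (bar S M 0)
  | k + 1, j => Fin.cases (motive := fun _ => bar S M (k + 2) →ₗ[A] bar S M (k + 1))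
      (barAct S (bar S M (k + 1))) (fun i => barStepMap S (barFace M k i)) j

theorem barFace_zero_mk (M : RingBimodule.{u, v, u} A T) (k : ℕ) (a : A) (x : bar S M k) :
    barFace S M k 0 (barMk S M k a x) = a • x := by
  cases k <;> rfl

theorem barFace_succ_mk (M : RingBimodule.{u, v, u} A T) (k : ℕ) (j : Fin (k + 1)) (a : A)
    (x : bar S M (k + 1)) :
    barFace S M (k + 1) j.succ (barMk S M (k + 1) a x) = barMk S M k a (barFace S M k j x) := rfl

theorem bar_smul_mk (M : RingBimodule.{u, v, u} A T) (k : ℕ) (a b : A) (x : bar S M k) :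
    a • barMk S M k b x = barMk S M k (a * b) x := rfl

theorem bar_op_smul_mk (M : RingBimodule.{u, v, u} A T) (k : ℕ) (a : A) (t : Tᵐᵒᵖ)
    (x : bar S M k) : t • barMk S M k a x = barMk S M k a (t • x) := rfl

/-- The differential `d_k = ∑_j (-1)^j d_{k,j} : B_k(A,S,M) → B_{k-1}(A,S,M)`. -/
def barD (M : RingBimodule.{u, v, u} A T) (k : ℕ) : bar S M (k + 1) →ₗ[A] bar S M k :=
  ∑ j : Fin (k + 1), (-1 : ℤ) ^ (j : ℕ) • barFace S M k j

theorem barD_apply (M : RingBimodule.{u, v, u} A T) (k : ℕ) (x : bar S M (k + 1)) :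
    barD S M k x = ∑ j : Fin (k + 1), (-1 : ℤ) ^ (j : ℕ) • barFace S M k j x := by
  rw [barD, LinearMap.sum_apply]
  rfl

theorem barD_zero_mk (M : RingBimodule.{u, v, u} A T) (a : A) (x : bar S M 0) :
    barD S M 0 (barMk S M 0 a x) = a • x := by
  rw [barD_apply, Fin.sum_univ_succ, Fin.sum_univ_zero, add_zero, barFace_zero_mk]
  exact one_smul ℤ _

theorem barD_succ_mk (M : RingBimodule.{u, v, u} A T) (k : ℕ) (a : A) (x : bar S M (k + 1)) :
    barD S M (k + 1) (barMk S M (k + 1) a x) = a • x - barMk S M k a (barD S M k x) := by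
  rw [barD_apply, Fin.sum_univ_succ, barFace_zero_mk, barD_apply, map_sum, sub_eq_add_neg,
    ← Finset.sum_neg_distrib]
  congr 1
  · exact one_smul ℤ _
  · refine Finset.sum_congr rfl fun j _ => ?_
    rw [map_zsmul, barFace_succ_mk, Fin.val_succ, pow_succ, mul_neg_one, neg_smul]

theorem barD_barD (M : RingBimodule.{u, v, u} A T) (k : ℕ) (x : bar S M (k + 2)) :
    barD S M k (barD S M (k + 1) x) = 0 := by
  induction k with
  | zero =>
    induction x using bar_induction with
    | zero => simp
    | mk a y => rw [barD_succ_mk, map_sub, map_smul, barD_zero_mk, sub_self]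
    | add x y hx hy => rw [map_add, map_add, hx, hy, add_zero]
  | succ k ih =>
    induction x using bar_induction with
    | zero => simp
    | mk a y => rw [barD_succ_mk, map_sub, map_smul, barD_succ_mk, ih, map_zero, sub_zero, sub_self]
    | add x y hx hy => rw [map_add, map_add, hx, hy, add_zero]

theorem barD_smul_right (M : RingBimodule.{u, v, u} A T) (k : ℕ) (t : Tᵐᵒᵖ)
    (x : bar S M (k + 1)) : barD S M k (t • x) = t • barD S M k x := by
  induction k with
  | zero =>
    induction x using bar_induction with
    | zero => simp
    | mk a y => rw [bar_op_smul_mk, barD_zero_mk, barD_zero_mk, smul_comm]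
    | add x y hx hy => rw [smul_add, map_add, map_add, hx, hy, smul_add]
  | succ k ih =>
    induction x using bar_induction with
    | zero => simp
    | mk a y =>
      rw [bar_op_smul_mk, barD_succ_mk, barD_succ_mk, ih, smul_sub, bar_op_smul_mk, smul_comm]
    | add x y hx hy => rw [smul_add, map_add, map_add, hx, hy, smul_add]

/-- The differential of the bar resolution as a homomorphism of right `T`-modules. -/
def barDRight (M : RingBimodule.{u, v, u} A T) (k : ℕ) :
    bar S M (k + 1) →ₗ[Tᵐᵒᵖ] bar S M k where
  toFun := barD S M k
  map_add' := map_add _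
  map_smul' := barD_smul_right S M k

end Bar

/-! ### Relative Tor groups -/

section RelTor

/-- The ring `A` as an `(A, A)`-bimodule. -/
def regularBimodule (A : Type u) [Ring A] : RingBimodule.{u, u, u} A A where
  carrier := A

variable {A : Type u} [Ring A] (S : Subring A)
  (N : Type v) [AddCommGroup N] [Module Aᵐᵒᵖ N] (M : Type w) [AddCommGroup M] [Module A M]

/-- The abelian group `N ⊗_A (B_k(A,S,A) ⊗_A M)`, for `k ≥ 0`. -/
abbrev relTorObj (k : ℕ) : Type (max u v w) :=
  RingTensor A N (RingTensor A (bar S (regularBimodule A) (k + 1)) M)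

/-- The differential `id_N ⊗ d_{k+1} ⊗ id_M`. -/
def relTorD (k : ℕ) : relTorObj S N M (k + 1) →+ relTorObj S N M k :=
  RingTensor.map LinearMap.id
    (RingTensor.mapLeft (T := A) (barDRight S (regularBimodule A) (k + 1)) LinearMap.id
      (fun a x => map_smul (barD S (regularBimodule A) (k + 1)) a x))

theorem relTorD_relTorD (k : ℕ) (x : relTorObj S N M (k + 2)) :
    relTorD S N M k (relTorD S N M (k + 1) x) = 0 := by
  induction x using RingTensor.induction_on with
  | zero => simp
  | tmul n y =>
    induction y using RingTensor.induction_on with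
    | zero => rw [RingTensor.tmul_zero]; simp
    | tmul b m =>
      change RingTensor.tmul A n (RingTensor.tmul A
        (barD S (regularBimodule A) (k + 1) (barD S (regularBimodule A) (k + 2) b)) m) = 0
      rw [barD_barD, RingTensor.zero_tmul, RingTensor.tmul_zero]
    | add x y hx hy => rw [RingTensor.tmul_add, map_add, map_add, hx, hy, add_zero]
  | add x y hx hy => rw [map_add, map_add, hx, hy, add_zero]

/-- The chain complex `N ⊗_A β(A,S,A) ⊗_A M` of abelian groups, where `β(A,S,A)` is the bar
resolution of `A` with its term in degree `-1` deleted. -/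
def relTorComplex : ChainComplex AddCommGrpCat.{max u v w} ℕ :=
  ChainComplex.of (fun k => AddCommGrpCat.of (relTorObj S N M k))
    (fun k => AddCommGrpCat.ofHom (relTorD S N M k))
    (fun k => by
      ext x
      exact relTorD_relTorD S N M k x)

/-- The relative Tor group `Tor_k^{(A,S)}(N, M) = H_k(N ⊗_A β(A,S,A) ⊗_A M)`. -/
def relTor (k : ℕ) : AddCommGrpCat.{max u v w} :=
  (relTorComplex S N M).homology k

end RelTor

/-! ### Stratifying ideals and LU-decompositions -/

section Stratifying

variable {A : Type u} [Ring A]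

/-- The ideal `AeA`, that is, all finite sums of elements `a e b`. -/
def idempotentIdeal (e : A) : Ideal A :=
  Ideal.span {x | ∃ a b : A, x = a * e * b}

instance idempotentIdeal_isTwoSided (e : A) : (idempotentIdeal e).IsTwoSided where
  mul_mem_of_left {x} c hx := by
    refine Submodule.span_induction (p := fun x _ => x * c ∈ idempotentIdeal e) ?_ ?_ ?_ ?_ hx
    · rintro _ ⟨a, b, rfl⟩
      exact Ideal.subset_span ⟨a, b * c, by rw [mul_assoc (a * e) b c]⟩
    · simp
    · intro x y _ _ hx hy
      rw [add_mul]
      exact add_mem hx hy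
    · intro a x _ hx
      rw [smul_eq_mul, mul_assoc]
      exact Ideal.mul_mem_left _ a hx

/-- `AeA` is `(A,S)`-stratifying: `Tor_k^{(A,S)}(A/AeA, A/AeA) = 0` for all `k ≥ 1`. -/
def IsRelStratifying (S : Subring A) (e : A) : Prop :=
  ∀ k : ℕ, 1 ≤ k → Limits.IsZero (relTor S (A ⧸ idempotentIdeal e) (A ⧸ idempotentIdeal e) k)

/-- `B` is upper triangular with respect to `e`: `(1 - e) B e = 0`. -/
def IsUpperTriangular (e : A) (B : Subring A) : Prop := ∀ b ∈ B, (1 - e) * b * e = 0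

/-- `B` is lower triangular with respect to `e`: `e B (1 - e) = 0`. -/
def IsLowerTriangular (e : A) (B : Subring A) : Prop := ∀ b ∈ B, e * b * (1 - e) = 0

/-- `B` is diagonal with respect to `e`: `(1 - e) B e = 0 = e B (1 - e)`. -/
def IsDiagonal (e : A) (B : Subring A) : Prop :=
  (∀ b ∈ B, (1 - e) * b * e = 0) ∧ ∀ b ∈ B, e * b * (1 - e) = 0

/-- A subring containing `S` as a left `S`-module. -/
abbrev leftModuleOfLE {S B : Subring A} (h : S ≤ B) : Module S B :=
  Module.compHom B (Subring.inclusion h)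

/-- A subring containing `S` as a right `S`-module. -/
abbrev rightModuleOfLE {S B : Subring A} (h : S ≤ B) : Module (↥S)ᵐᵒᵖ B :=
  Module.compHom B (RingHom.op (Subring.inclusion h))

/-- The tensor product `A₁ ⊗_S A₂` of two subrings containing `S`. -/
abbrev SubringTensor {S A₁ A₂ : Subring A} (h₁ : S ≤ A₁) (h₂ : S ≤ A₂) : Type u :=
  letI := rightModuleOfLE h₁
  letI := leftModuleOfLE h₂
  RingTensor S A₁ A₂

/-- The map `α : A₁ ⊗_S A₂ → A`, `x ⊗ y ↦ x y`. -/
def subringMul {S A₁ A₂ : Subring A} (h₁ : S ≤ A₁) (h₂ : S ≤ A₂) : SubringTensor h₁ h₂ →+ A :=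
  letI := rightModuleOfLE h₁
  letI := leftModuleOfLE h₂
  RingTensor.lift (R := S) (N := A₁) (M := A₂)
    (AddMonoidHom.mk'
      (fun x => AddMonoidHom.mk' (fun y : A₂ => (x : A) * (y : A)) (fun y y' => by simp [mul_add]))
      (fun x x' => by ext y; simp [add_mul]))
    (fun x s y => mul_assoc (x : A) (s : A) (y : A))

/-- `(A,S)` is a twisted product of the subrings `A₁` and `A₂` containing `S`. -/
structure IsTwistedProduct (S A₁ A₂ : Subring A) : Prop where
  le_left : S ≤ A₁
  le_right : S ≤ A₂
  bijective : Function.Bijective (subringMul le_left le_right)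

/-- The subrings `L` and `U` form an `LU`-decomposition of `(A,S)` with respect to `e`. -/
structure IsLUDecomposition (S : Subring A) (e : A) (L U : Subring A) : Prop where
  twisted : IsTwistedProduct S L U
  lower : IsLowerTriangular e L
  upper : IsUpperTriangular e U

end Stratifying

end

noncomputable section

/-! ### Functoriality of tensor products -/

namespace RingTensor

variable {R : Type*} [Ring R] {N M M' M'' : Type*}
  [AddCommGroup N] [Module Rᵐᵒᵖ N]
  [AddCommGroup M] [Module R M] [AddCommGroup M'] [Module R M'] [AddCommGroup M''] [Module R M'']

/-! Put `N = A/AeA`, so `N e = 0`. Since `B(A,S,A) ⊗_A M` is `B(A,S,M)`, the claim is that `N ⊗_A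
B(A,S,X)` is exact in positive degrees for `X = A/AeA`. This is obtained by dimension shifting in
the second variable.

Upper triangularity makes `eU` a left ideal of `U`, and lower triangularity of `L` shows that `1 ⊗
1` in `A ⊗_U (U/eU)` is killed by `AeA`. Hence `A/AeA` is a retract of `A ⊗_U (U/eU)`
(`cornerToQuotient_comp`), and it suffices to treat the latter module.

The twisted product gives `A ⊗_U Y = L ⊗_S Y`, which is functorial for maps that are merely
`S`-linear (`relExtMap`). Extension of scalars therefore turns `S`-split sequences of `U`-modules
into `S`-split sequences of `A`-modules, and these allow dimension shifting
(`RelSplitSeq.isTensorAcyclic_succ`).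

Diagonality of `S` means that `e` commutes with `S`, so `eU → U → U/eU` splits over `S`. Its middle
term extends to `A`, which is relatively projective. It remains to kill the relative Tor groups of
`A ⊗_U Y` when `e` is the identity on `Y`, as for `Y = eU` (`isTensorAcyclic_extension`). There `N
⊗_A (A ⊗_U Y) = 0` because `N e = 0`. The `S`-split cover `U ⊗_S Y → Y` extends to a cover by the
relatively projective `A ⊗_S Y`. By upper triangularity `e` is again the identity on `U ⊗_S Y`,
hence on the kernel, and induction on the degree applies. -/

theorem map_id_map_id (g : M' →ₗ[R] M'') (f : M →ₗ[R] M') (x : RingTensor R N M) :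
    map LinearMap.id g (map LinearMap.id f x) = map LinearMap.id (g ∘ₗ f) x := by
  induction x using induction_on with
  | zero => simp
  | tmul n m => simp
  | add x y hx hy => simp only [map_add, hx, hy]

theorem map_id_id (x : RingTensor R N M) :
    map (LinearMap.id : N →ₗ[Rᵐᵒᵖ] N) (LinearMap.id : M →ₗ[R] M) x = x := by
  induction x using induction_on with
  | zero => simp
  | tmul n m => simp
  | add x y hx hy => simp only [map_add, hx, hy]

theorem map_id_add (f g : M →ₗ[R] M') (x : RingTensor R N M) :
    map LinearMap.id (f + g) x = map LinearMap.id f x + map LinearMap.id g x := by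
  induction x using induction_on with
  | zero => simp
  | tmul n m => simp [tmul_add]
  | add x y hx hy => simp only [map_add, hx, hy]; abel

theorem map_id_zsmul (c : ℤ) (f : M →ₗ[R] M') (x : RingTensor R N M) :
    map LinearMap.id (c • f) x = c • map LinearMap.id f x := by
  induction x using induction_on with
  | zero => simp
  | tmul n m =>
    rw [map_tmul, map_tmul, LinearMap.smul_apply]
    exact map_zsmul (AddMonoidHom.mk' (fun m : M' => tmul R n m) (tmul_add n)) c (f m)
  | add x y hx hy => simp only [map_add, hx, hy, smul_add]

theorem map_id_zero (x : RingTensor R N M) :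
    map (LinearMap.id : N →ₗ[Rᵐᵒᵖ] N) (0 : M →ₗ[R] M') x = 0 := by
  induction x using induction_on with
  | zero => simp
  | tmul n m => simp [tmul_zero]
  | add x y hx hy => simp only [map_add, hx, hy, add_zero]

end RingTensor

/-! ### Functoriality of the bar resolution for `S`-linear maps -/

section BarMap

variable {A : Type u} [Ring A] (S : Subring A)

/-- The `A`-linear map `id_A ⊗ g : A ⊗_S X → A ⊗_S Y` induced by an `S`-linear map `g`. -/
def inducedMap {X Y : Type*} [AddCommGroup X] [Module S X] [AddCommGroup Y] [Module S Y]
    (g : X →ₗ[S] Y) : RingTensor S A X →ₗ[A] RingTensor S A Y :=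
  RingTensor.mapLeft (T := A) LinearMap.id g (fun _ _ => rfl)

variable {T T' T'' : Type*} [Ring T] [Ring T'] [Ring T'']
  {X : RingBimodule A T} {Y : RingBimodule A T'} {Z : RingBimodule A T''}

/-- The map of bar constructions induced by an `S`-linear map. -/
def barMap (f : X →ₗ[S] Y) : (k : ℕ) → (bar S X k →ₗ[S] bar S Y k)
  | 0 => f
  | k + 1 =>
    { toFun := inducedMap S (barMap f k)
      map_add' := map_add (inducedMap S (barMap f k))
      map_smul' := fun s x => map_smul (inducedMap S (barMap f k)) (s : A) x }

/-- In positive degrees the map of bar constructions induced by an `S`-linear map is `A`-linear. -/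
def barMapSucc (f : X →ₗ[S] Y) (k : ℕ) : bar S X (k + 1) →ₗ[A] bar S Y (k + 1) :=
  inducedMap S (barMap S f k)

theorem barMap_succ_apply (f : X →ₗ[S] Y) (k : ℕ) (x : bar S X (k + 1)) :
    barMap S f (k + 1) x = barMapSucc S f k x := rfl

theorem barMapSucc_mk (f : X →ₗ[S] Y) (k : ℕ) (a : A) (x : bar S X k) :
    barMapSucc S f k (barMk S X k a x) = barMk S Y k a (barMap S f k x) := rfl

/-- Compatibility with composition, identities and sums carries the identities of an `S`-splitting
to every degree of the bar construction. -/
theorem barMap_comp (g : Y →ₗ[S] Z) (f : X →ₗ[S] Y) (k : ℕ) :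
    barMap S (g ∘ₗ f) k = barMap S g k ∘ₗ barMap S f k := by
  induction k with
  | zero => rfl
  | succ k ih =>
    ext x
    induction x using bar_induction with
    | zero => simp
    | mk a y =>
      simp only [LinearMap.comp_apply, barMap_succ_apply, barMapSucc_mk, ih]
    | add x y hx hy => rw [map_add, map_add, hx, hy]

theorem barMap_id (k : ℕ) : barMap S (LinearMap.id : X →ₗ[S] X) k = LinearMap.id := by
  induction k with
  | zero => rfl
  | succ k ih =>
    ext x
    induction x using bar_induction with
    | zero => simp
    | mk a y => simp only [barMap_succ_apply, barMapSucc_mk, ih, LinearMap.id_apply]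
    | add x y hx hy => rw [map_add, map_add, hx, hy]

theorem barMap_add (f g : X →ₗ[S] Y) (k : ℕ) :
    barMap S (f + g) k = barMap S f k + barMap S g k := by
  induction k with
  | zero => rfl
  | succ k ih =>
    ext x
    induction x using bar_induction with
    | zero => simp
    | mk a y =>
      simp only [barMap_succ_apply, barMapSucc_mk, ih, LinearMap.add_apply, map_add]
    | add x y hx hy => rw [map_add, map_add, hx, hy]

theorem barMapSucc_comp (g : Y →ₗ[S] Z) (f : X →ₗ[S] Y) (k : ℕ) :
    barMapSucc S (g ∘ₗ f) k = barMapSucc S g k ∘ₗ barMapSucc S f k := by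
  ext x
  exact LinearMap.congr_fun (barMap_comp S g f (k + 1)) x

theorem barMapSucc_id (k : ℕ) : barMapSucc S (LinearMap.id : X →ₗ[S] X) k = LinearMap.id := by
  ext x
  exact LinearMap.congr_fun (barMap_id S (k + 1)) x

theorem barMapSucc_add (f g : X →ₗ[S] Y) (k : ℕ) :
    barMapSucc S (f + g) k = barMapSucc S f k + barMapSucc S g k := by
  ext x
  exact LinearMap.congr_fun (barMap_add S f g (k + 1)) x

theorem barMap_smul (f : X →ₗ[A] Y) (k : ℕ) (a : A) (x : bar S X k) :
    barMap S (f.restrictScalars S) k (a • x) = a • barMap S (f.restrictScalars S) k x := by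
  cases k with
  | zero => exact map_smul f a x
  | succ k => exact map_smul (barMapSucc S (f.restrictScalars S) k) a x

/-- The innermost face multiplies into `X`, so commuting with the differential needs `f` to be
`A`-linear. An `S`-linear map gives only maps in each degree. -/
theorem barMap_barD (f : X →ₗ[A] Y) (k : ℕ) (x : bar S X (k + 1)) :
    barMap S (f.restrictScalars S) k (barD S X k x) =
      barD S Y k (barMapSucc S (f.restrictScalars S) k x) := by
  induction k with
  | zero =>
    induction x using bar_induction with
    | zero => simp
    | mk a y => rw [barD_zero_mk, barMapSucc_mk, barD_zero_mk, barMap_smul]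
    | add x y hx hy => simp only [map_add, hx, hy]
  | succ k ih =>
    induction x using bar_induction with
    | zero => simp
    | mk a y =>
      rw [barD_succ_mk, barMapSucc_mk, barD_succ_mk, map_sub, barMap_smul, barMap_succ_apply,
        barMap_succ_apply, barMapSucc_mk, ih]
    | add x y hx hy => simp only [map_add, hx, hy]

end BarMap

/-! ### Acyclicity of tensored bar resolutions -/

section Acyclic

variable {A : Type u} [Ring A] (S : Subring A)
  (N : Type*) [AddCommGroup N] [Module Aᵐᵒᵖ N]

/-- The differential `id_N ⊗ d_k` on `N ⊗_A B(A,S,X)`. -/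
def tensorBarD {T : Type*} [Ring T] (X : RingBimodule A T) (k : ℕ) :
    RingTensor A N (bar S X (k + 1)) →+ RingTensor A N (bar S X k) :=
  RingTensor.map LinearMap.id (barD S X k)

/-- Exactness of `N ⊗_A B(A,S,X)` at the term with `k + 1` factors `A`. -/
def IsTensorAcyclic {T : Type*} [Ring T] (X : RingBimodule A T) (k : ℕ) : Prop :=
  ∀ x : RingTensor A N (bar S X (k + 1)), tensorBarD S N X k x = 0 →
    ∃ y, tensorBarD S N X (k + 1) y = x

variable {T T' T'' : Type*} [Ring T] [Ring T'] [Ring T'']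
  {X : RingBimodule A T} {Y : RingBimodule A T'} {Z : RingBimodule A T''}

/-- The map `N ⊗_A B_k(A,S,X) → N ⊗_A B_k(A,S,Y)` induced by an `S`-linear map. -/
def tensorBarMap (f : X →ₗ[S] Y) (k : ℕ) :
    RingTensor A N (bar S X (k + 1)) →+ RingTensor A N (bar S Y (k + 1)) :=
  RingTensor.map LinearMap.id (barMapSucc S f k)

theorem tensorBarMap_comp (g : Y →ₗ[S] Z) (f : X →ₗ[S] Y) (k : ℕ)
    (x : RingTensor A N (bar S X (k + 1))) :
    tensorBarMap S N g k (tensorBarMap S N f k x) = tensorBarMap S N (g ∘ₗ f) k x := by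
  rw [tensorBarMap, tensorBarMap, RingTensor.map_id_map_id, tensorBarMap, barMapSucc_comp]

theorem tensorBarMap_id (k : ℕ) (x : RingTensor A N (bar S X (k + 1))) :
    tensorBarMap S N (LinearMap.id : X →ₗ[S] X) k x = x := by
  rw [tensorBarMap, barMapSucc_id, RingTensor.map_id_id]

theorem tensorBarMap_add (f g : X →ₗ[S] Y) (k : ℕ) (x : RingTensor A N (bar S X (k + 1))) :
    tensorBarMap S N (f + g) k x = tensorBarMap S N f k x + tensorBarMap S N g k x := by
  rw [tensorBarMap, barMapSucc_add, RingTensor.map_id_add]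
  rfl

theorem tensorBarD_tensorBarMap (f : X →ₗ[A] Y) (k : ℕ)
    (x : RingTensor A N (bar S X (k + 2))) :
    tensorBarD S N Y (k + 1) (tensorBarMap S N (f.restrictScalars S) (k + 1) x) =
      tensorBarMap S N (f.restrictScalars S) k (tensorBarD S N X (k + 1) x) := by
  rw [tensorBarD, tensorBarD, tensorBarMap, tensorBarMap, RingTensor.map_id_map_id,
    RingTensor.map_id_map_id]
  congr 2
  ext x
  exact (barMap_barD S f (k + 1) x).symm

theorem tensorBarD_tensorBarD (X : RingBimodule A T) (k : ℕ)
    (x : RingTensor A N (bar S X (k + 2))) :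
    tensorBarD S N X k (tensorBarD S N X (k + 1) x) = 0 := by
  rw [tensorBarD, tensorBarD, RingTensor.map_id_map_id]
  convert RingTensor.map_id_zero x
  ext x
  exact barD_barD S X k x

/-- Acyclicity passes to retracts. -/
theorem IsTensorAcyclic.of_retract {k : ℕ} (f : X →ₗ[A] Y) (g : Y →ₗ[A] X)
    (hgf : g ∘ₗ f = LinearMap.id) (h : IsTensorAcyclic S N Y (k + 1)) :
    IsTensorAcyclic S N X (k + 1) := by
  intro x hx
  obtain ⟨y, hy⟩ := h (tensorBarMap S N (f.restrictScalars S) (k + 1) x) (by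
    rw [tensorBarD_tensorBarMap, hx, map_zero])
  refine ⟨tensorBarMap S N (g.restrictScalars S) (k + 2) y, ?_⟩
  rw [tensorBarD_tensorBarMap, hy, tensorBarMap_comp, ← LinearMap.restrictScalars_comp, hgf]
  exact tensorBarMap_id S N (k + 1) x

/-! #### Relatively projective modules -/

/-- The maps `id_A ⊗ ⋯ ⊗ id_A ⊗ τ` induced by `τ : X → A ⊗_S X`. -/
def barHomotopy {X : RingBimodule A T} (τ : X →ₗ[A] bar S X 1) :
    (k : ℕ) → (bar S X k →ₗ[A] bar S X (k + 1))
  | 0 => τ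
  | k + 1 => barStepMap S (barHomotopy τ k)

theorem barHomotopy_succ_mk {X : RingBimodule A T} (τ : X →ₗ[A] bar S X 1) (k : ℕ) (a : A)
    (x : bar S X k) : barHomotopy S τ (k + 1) (barMk S X k a x) =
      barMk S X (k + 1) a (barHomotopy S τ k x) := rfl

/-- Inserting `τ` at the innermost place commutes with the faces `0, …, k`, as `τ` is `A`-linear.
The last face undoes `τ` and contributes the sign. Unlike the usual contraction `x ↦ 1 ⊗ x`, this
one is `A`-linear and so survives `N ⊗_A -`. -/
theorem barD_barHomotopy {X : RingBimodule A T} (τ : X →ₗ[A] bar S X 1)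
    (hτ : ∀ x : X, barD S X 0 (τ x) = x) (k : ℕ) (x : bar S X (k + 1)) :
    barD S X (k + 1) (barHomotopy S τ (k + 1) x) =
      barHomotopy S τ k (barD S X k x) + (-1 : ℤ) ^ (k + 1) • x := by
  induction k with
  | zero =>
    induction x using bar_induction with
    | zero => simp
    | mk a y =>
      rw [barHomotopy_succ_mk, barD_succ_mk, barD_zero_mk, map_smul]
      have h : barD S X 0 (barHomotopy S τ 0 y) = y := hτ y
      rw [h, pow_succ, pow_zero, one_mul, neg_one_smul, sub_eq_add_neg]
    | add x y hx hy => simp only [map_add, hx, hy, smul_add]; abel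
  | succ k ih =>
    induction x using bar_induction with
    | zero => simp
    | mk a y =>
      rw [barHomotopy_succ_mk, barD_succ_mk, ih, barD_succ_mk, map_sub, map_smul,
        barHomotopy_succ_mk, map_add, map_zsmul, pow_succ _ (k + 1), mul_neg_one, neg_smul]
      abel
    | add x y hx hy => simp only [map_add, hx, hy, smul_add]; abel

theorem barD_zero_apply (X : RingBimodule A T) (x : barStep S X) :
    barD S X 0 x = barAct S X x := by
  refine (barD_apply S X 0 x).trans ?_
  rw [Fin.sum_univ_succ, Fin.sum_univ_zero, add_zero]
  exact one_smul ℤ (barAct S X x)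

/-- Relatively projective modules are acyclic. -/
theorem isTensorAcyclic_of_section {X : RingBimodule A T} (τ : X →ₗ[A] barStep S X)
    (hτ : ∀ x : X, barAct S X (τ x) = x) (k : ℕ) : IsTensorAcyclic S N X k := by
  replace hτ (x : X) : barD S X 0 (τ x) = x := (barD_zero_apply S X (τ x)).trans (hτ x)
  intro x hx
  have h : tensorBarD S N X (k + 1) (RingTensor.map LinearMap.id (barHomotopy S τ (k + 1)) x) =
      (-1 : ℤ) ^ (k + 1) • x := by
    have h' : barD S X (k + 1) ∘ₗ barHomotopy S τ (k + 1) =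
        barHomotopy S τ k ∘ₗ barD S X k + (-1 : ℤ) ^ (k + 1) • LinearMap.id := by
      ext x
      exact barD_barHomotopy S τ hτ k x
    rw [tensorBarD, RingTensor.map_id_map_id, h', RingTensor.map_id_add, RingTensor.map_id_zsmul,
      RingTensor.map_id_id, ← RingTensor.map_id_map_id]
    rw [tensorBarD] at hx
    rw [hx, map_zero, zero_add]
  -- The homotopy returns a cycle only up to `(-1)^(k+1)`, so the preimage carries the same sign.
  refine ⟨(-1 : ℤ) ^ (k + 1) • RingTensor.map LinearMap.id (barHomotopy S τ (k + 1)) x, ?_⟩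
  rw [map_zsmul, h, smul_smul, ← mul_pow, neg_one_mul, neg_neg, one_pow, one_smul]

/-! #### Dimension shifting along `S`-split sequences -/

/-- A short exact sequence of `A`-modules `K → P → Q` with a splitting over `S`. -/
structure RelSplitSeq (K : RingBimodule A T) (P : RingBimodule A T') (Q : RingBimodule A T'') where
  i : K →ₗ[A] P
  p : P →ₗ[A] Q
  r : P →ₗ[S] K
  s : Q →ₗ[S] P
  r_i : r ∘ₗ i.restrictScalars S = LinearMap.id
  p_s : p.restrictScalars S ∘ₗ s = LinearMap.id
  i_r_add_s_p : i.restrictScalars S ∘ₗ r + s ∘ₗ p.restrictScalars S = LinearMap.id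

namespace RelSplitSeq

variable {S} {K : RingBimodule A T} {P : RingBimodule A T'} {Q : RingBimodule A T''}

/-- Since `N ⊗_A P = 0`, every element of `N ⊗_A B_0(A,S,P)` is a cycle, hence a boundary. Elements
over `Q` lift along `s`, and the `A`-linear `p` carries the bounding element back. -/
theorem isTensorAcyclic_zero (E : RelSplitSeq S K P Q) [Subsingleton (RingTensor A N P)]
    (hP : IsTensorAcyclic S N P 0) :
    IsTensorAcyclic S N Q 0 := by
  intro x _
  obtain ⟨y, hy⟩ := hP (tensorBarMap S N E.s 0 x)
    (Subsingleton.elim (α := RingTensor A N P) _ _)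
  refine ⟨tensorBarMap S N (E.p.restrictScalars S) 1 y, ?_⟩
  rw [tensorBarD_tensorBarMap, hy, tensorBarMap_comp, E.p_s, tensorBarMap_id]

/-- This is the chase behind exactness of `Tor_{k+1}(P) → Tor_{k+1}(Q) → Tor_k(K)`. The complexes `N
⊗_A B` form a split sequence in each degree, because `id_A ⊗ g` is `A`-linear even when `g` is only
`S`-linear. -/
theorem isTensorAcyclic_succ (E : RelSplitSeq S K P Q) [Subsingleton (RingTensor A N K)]
    {k : ℕ} (hP : IsTensorAcyclic S N P (k + 1)) (hK : IsTensorAcyclic S N K k) :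
    IsTensorAcyclic S N Q (k + 1) := by
  intro x hx
  -- An element killed by `p` comes from `K`: apply `i r + s p = 1` to it.
  have key (j : ℕ) (w : RingTensor A N (bar S P (j + 1)))
      (hw : tensorBarMap S N (E.p.restrictScalars S) j w = 0) :
      tensorBarMap S N (E.i.restrictScalars S) j (tensorBarMap S N E.r j w) = w := by
    have h := tensorBarMap_id S N (X := P) j w
    rwa [← E.i_r_add_s_p, tensorBarMap_add, ← tensorBarMap_comp, ← tensorBarMap_comp, hw,
      map_zero, add_zero] at h
  set x' := tensorBarMap S N E.s (k + 1) x with hx'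
  have hpx' : tensorBarMap S N (E.p.restrictScalars S) (k + 1) x' = x := by
    rw [hx', tensorBarMap_comp, E.p_s, tensorBarMap_id]
  set z := tensorBarMap S N E.r k (tensorBarD S N P (k + 1) x') with hz
  have hiz : tensorBarMap S N (E.i.restrictScalars S) k z = tensorBarD S N P (k + 1) x' := by
    refine key _ _ ?_
    rw [← tensorBarD_tensorBarMap, hpx', hx]
  have hdz : tensorBarD S N K k z = 0 := by
    -- In positive degrees `i` is split injective, so `i d z = d i z = d d x' = 0` suffices. The
    -- augmentation term `N ⊗_A K` has no such splitting, as `r` is only `S`-linear; there its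
    -- vanishing is what helps.
    cases k with
    | zero => exact Subsingleton.elim (α := RingTensor A N K) _ _
    | succ k =>
      have h := tensorBarMap_id S N k (tensorBarD S N K (k + 1) z)
      rw [← E.r_i, ← tensorBarMap_comp, ← tensorBarD_tensorBarMap, hiz, tensorBarD_tensorBarD,
        map_zero] at h
      exact h.symm
  obtain ⟨w, hw⟩ := hK z hdz
  obtain ⟨y, hy⟩ := hP (x' - tensorBarMap S N (E.i.restrictScalars S) (k + 1) w) (by
    rw [map_sub, tensorBarD_tensorBarMap, hw, hiz, sub_self])
  refine ⟨tensorBarMap S N (E.p.restrictScalars S) (k + 2) y, ?_⟩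
  -- `p i = 0` follows from the splitting: `i = (i r + s p) i = i + s p i` gives `s p i = 0`, and `p
  -- s = 1`.
  have hpi : tensorBarMap S N (E.p.restrictScalars S) (k + 1)
      (tensorBarMap S N (E.i.restrictScalars S) (k + 1) w) = 0 := by
    have h := tensorBarMap_id S N (X := P) (k + 1)
      (tensorBarMap S N (E.i.restrictScalars S) (k + 1) w)
    rw [← E.i_r_add_s_p, tensorBarMap_add, ← tensorBarMap_comp, tensorBarMap_comp S N E.r, E.r_i,
      tensorBarMap_id, add_eq_left, ← tensorBarMap_comp] at h
    have h' := congrArg (tensorBarMap S N (E.p.restrictScalars S) (k + 1)) h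
    rwa [tensorBarMap_comp S N _ E.s, E.p_s, tensorBarMap_id, map_zero] at h'
  rw [tensorBarD_tensorBarMap, hy, map_sub, hpx', hpi, sub_zero]

end RelSplitSeq

end Acyclic

/-! ### Extension of scalars along `U ⊆ A` -/

/-- A left `A`-module as an `(A, ℤ)`-bimodule. -/
def leftBimodule (A : Type u) [Ring A] (X : Type w) [AddCommGroup X] [Module A X] :
    RingBimodule.{u, 0, w} A ℤ :=
  letI : Module ℤᵐᵒᵖ X := Module.compHom X (RingEquiv.toOpposite ℤ).symm.toRingHom
  { carrier := X
    smulComm := ⟨fun a z x => smul_comm a (unop z) x⟩ }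

section Extension

variable {A : Type u} [Ring A]

/-- The left `A`-module `A ⊗_U Y`. -/
def extension (U : Subring A) (Y : Type u) [AddCommGroup Y] [Module U Y] :
    RingBimodule.{u, 0, u} A ℤ :=
  leftBimodule A (RingTensor U A Y)

/-- The pure tensor `a ⊗ y` in `A ⊗_U Y`. -/
def extMk (U : Subring A) {Y : Type u} [AddCommGroup Y] [Module U Y] (a : A) :
    Y →+ extension U Y :=
  AddMonoidHom.mk' (fun y => (RingTensor.tmul U a y : RingTensor U A Y))
    (fun x y => RingTensor.tmul_add a x y)

/-! ### Universal property of `A ⊗_U Y`, and its vanishing after `N ⊗_A -` -/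

section Basic

variable {U : Subring A} {Y Z : Type u} [AddCommGroup Y] [Module U Y] [AddCommGroup Z] [Module U Z]

theorem extMk_add (a b : A) (y : Y) : extMk U (a + b) y = extMk U a y + extMk U b y :=
  RingTensor.add_tmul a b y

theorem extMk_zero (y : Y) : extMk U 0 y = 0 := RingTensor.zero_tmul y

theorem extMk_smul (a : A) (u : U) (y : Y) : extMk U a (u • y) = extMk U (a * u) y :=
  (RingTensor.smul_tmul a u y).symm

theorem smul_extMk (a b : A) (y : Y) : a • extMk U b y = extMk U (a * b) y := rfl

theorem extension_induction {p : extension U Y → Prop} (x : extension U Y) (zero : p 0)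
    (mk : ∀ a y, p (extMk U a y)) (add : ∀ x y, p x → p y → p (x + y)) : p x :=
  RingTensor.induction_on (R := U) (N := A) (M := Y) x zero mk add

/-- The universal property of `A ⊗_U Y`. -/
def extLift {X : Type*} [AddCommGroup X] [Module A X] (f : Y →+ X)
    (hf : ∀ (u : U) (y : Y), f (u • y) = (u : A) • f y) : extension U Y →ₗ[A] X :=
  RingTensor.liftLeft (R := U) (N := A) (M := Y) (T := A)
    (AddMonoidHom.mk' (fun a => AddMonoidHom.mk' (fun y => a • f y)
      (fun y y' => by rw [map_add, smul_add])) (fun a b => by ext y; exact add_smul a b (f y)))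
    (fun a u y => by
      change (a * (u : A)) • f y = a • f (u • y)
      rw [hf, mul_smul])
    (fun a b y => mul_smul a b (f y))

theorem extLift_mk {X : Type*} [AddCommGroup X] [Module A X] (f : Y →+ X)
    (hf : ∀ (u : U) (y : Y), f (u • y) = (u : A) • f y) (a : A) (y : Y) :
    extLift f hf (extMk U a y) = a • f y := rfl

/-- The `A`-linear map `A ⊗_U Y → A ⊗_U Z` induced by a `U`-linear map. -/
def extMap (f : Y →ₗ[U] Z) : extension U Y →ₗ[A] extension U Z :=
  extLift ((extMk U 1).comp f.toAddMonoidHom) (fun u y => by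
    change extMk U 1 (f (u • y)) = (u : A) • extMk U 1 (f y)
    rw [map_smul, extMk_smul, smul_extMk, one_mul, mul_one])

theorem extMap_mk (f : Y →ₗ[U] Z) (a : A) (y : Y) :
    extMap f (extMk U a y) = extMk U a (f y) := by
  refine (extLift_mk _ _ a y).trans ?_
  change a • extMk U 1 (f y) = _
  rw [smul_extMk, mul_one]

/-- `N ⊗_A (A ⊗_U Y) = 0` if `N e = 0` and `e` acts as the identity on `Y`. -/
theorem subsingleton_tensor_extension (N : Type*) [AddCommGroup N] [Module Aᵐᵒᵖ N] {e : A}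
    (heU : e ∈ U) (hN : ∀ n : N, op e • n = 0) (hY : ∀ y : Y, (⟨e, heU⟩ : U) • y = y) :
    Subsingleton (RingTensor A N (extension U Y)) := by
  refine subsingleton_of_forall_eq 0 fun x => ?_
  induction x using RingTensor.induction_on with
  | zero => rfl
  | tmul n x =>
    induction x using extension_induction with
    | zero => exact RingTensor.tmul_zero n
    | mk a y =>
      -- `n ⊗ (a ⊗ y) = n ⊗ (a ⊗ e y) = (n a) e ⊗ (1 ⊗ y)`, and `N e = 0`.
      rw [← hY y, extMk_smul, ← mul_one (a * _), ← smul_extMk, ← RingTensor.smul_tmul, op_mul,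
        mul_smul, hN, RingTensor.zero_tmul]
    | add x y hx hy => rw [RingTensor.tmul_add, hx, hy, add_zero]
  | add x y hx hy => rw [hx, hy, add_zero]

end Basic

/-! #### Functoriality for `S`-linear maps -/

theorem IsTwistedProduct.induction {S L U : Subring A} (hT : IsTwistedProduct S L U)
    {p : A → Prop} (a : A) (zero : p 0)
    (mul : ∀ l ∈ L, ∀ u ∈ U, p (l * u)) (add : ∀ x y, p x → p y → p (x + y)) : p a := by
  let := rightModuleOfLE hT.le_left
  let := leftModuleOfLE hT.le_right
  obtain ⟨t, rfl⟩ := hT.bijective.2 a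
  induction t using RingTensor.induction_on with
  | zero => rw [map_zero]; exact zero
  | tmul l u => exact mul l l.2 u u.2
  | add x y hx hy => rw [map_add]; exact add _ _ hx hy

variable {S L U : Subring A} (hT : IsTwistedProduct S L U)

/-- The subring `S` of `A` as a subring of `U`. -/
abbrev relSubring (S U : Subring A) : Subring U := S.comap U.subtype

variable {Y Z W : Type u} [AddCommGroup Y] [Module U Y] [AddCommGroup Z] [Module U Z]
  [AddCommGroup W] [Module U W]

/-- The map `L ⊗_S U → A ⊗_U Z`, `l ⊗ u ↦ l ⊗ g (u y)`. -/
def relExtAux (g : Y →ₗ[relSubring S U] Z) (y : Y) :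
    SubringTensor hT.le_left hT.le_right →+ extension U Z :=
  letI := rightModuleOfLE hT.le_left
  letI := leftModuleOfLE hT.le_right
  RingTensor.lift (R := S) (N := L) (M := U)
    (AddMonoidHom.mk' (fun l => AddMonoidHom.mk' (fun u : U => extMk U (l : A) (g (u • y)))
      (fun u u' => by rw [add_smul, map_add, map_add]))
      (fun l l' => by ext u; exact extMk_add (l : A) l' _))
    (fun l s u => by
      change extMk U ((l : A) * (s : A)) (g (u • y)) =
        extMk U (l : A) (g ((Subring.inclusion hT.le_right s * u) • y))
      rw [mul_smul]
      have h := map_smul g (⟨Subring.inclusion hT.le_right s, s.2⟩ : relSubring S U) (u • y)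
      refine Eq.trans ?_ (congrArg (extMk U (l : A)) h.symm)
      exact (extMk_smul (l : A) (Subring.inclusion hT.le_right s) (g (u • y))).symm)

/-- The function `A → A ⊗_U Z`, `l u ↦ l ⊗ g (u y)`. -/
def relExtFun (g : Y →ₗ[relSubring S U] Z) (y : Y) : A →+ extension U Z :=
  (relExtAux hT g y).comp (AddEquiv.ofBijective _ hT.bijective).symm.toAddMonoidHom

theorem relExtFun_mul (g : Y →ₗ[relSubring S U] Z) (y : Y) {l u : A} (hl : l ∈ L) (hu : u ∈ U) :
    relExtFun hT g y (l * u) = extMk U l (g ((⟨u, hu⟩ : U) • y)) := by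
  let := rightModuleOfLE hT.le_left
  let := leftModuleOfLE hT.le_right
  have h : (AddEquiv.ofBijective _ hT.bijective).symm (l * u) =
      RingTensor.tmul S (⟨l, hl⟩ : L) (⟨u, hu⟩ : U) := by
    rw [AddEquiv.symm_apply_eq]
    rfl
  change relExtAux hT g y ((AddEquiv.ofBijective _ hT.bijective).symm (l * u)) = _
  rw [h]
  rfl

/-- The `S`-linear map `A ⊗_U Y → A ⊗_U Z`, `l ⊗ y ↦ l ⊗ g y` for `l ∈ L`, induced by an
`S`-linear map `g : Y → Z`. -/
def relExtMap (g : Y →ₗ[relSubring S U] Z) : extension U Y →ₗ[S] extension U Z :=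
  let F : extension U Y →+ extension U Z := RingTensor.lift (R := U) (N := A) (M := Y)
    (AddMonoidHom.flip (AddMonoidHom.mk' (relExtFun hT g) (fun y y' => by
      ext a
      induction a using hT.induction with
      | zero => simp
      | mul l hl u hu =>
        simp only [AddMonoidHom.add_apply, relExtFun_mul hT _ _ hl hu, smul_add, map_add]
      | add a b ha hb => rw [map_add, map_add, ha, hb])))
    (fun a v y => by
      change relExtFun hT g y (a * (v : A)) = relExtFun hT g (v • y) a
      induction a using hT.induction with
      | zero => simp
      | mul l hl u hu =>
        -- Right multiplication by `v` changes only the `U`-factor of `l u`: both sides are `l ⊗ g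
        -- (u v y)`.
        rw [mul_assoc, relExtFun_mul hT _ _ hl (mul_mem hu v.2), relExtFun_mul hT _ _ hl hu,
          smul_smul]
        rfl
      | add a b ha hb => rw [add_mul, map_add, map_add, ha, hb])
  { toFun := F
    map_add' := map_add F
    map_smul' := fun s x => by
      induction x using extension_induction with
      | zero => simp
      | mk a y =>
        change relExtFun hT g y ((s : A) * a) = (s : A) • relExtFun hT g y a
        induction a using hT.induction with
        | zero => simp
        | mul l hl u hu =>
          -- Left multiplication by `S` keeps the first factor in `L`.
          rw [← mul_assoc, relExtFun_mul hT _ _ (mul_mem (hT.le_left s.2) hl) hu,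
            relExtFun_mul hT _ _ hl hu, smul_extMk]
        | add a b ha hb => rw [mul_add, map_add, map_add, ha, hb, smul_add]
      | add x y hx hy => rw [smul_add, map_add, hx, hy, map_add, smul_add] }

theorem relExtMap_mk (g : Y →ₗ[relSubring S U] Z) {l : A} (hl : l ∈ L) (y : Y) :
    relExtMap hT g (extMk U l y) = extMk U l (g y) := by
  change relExtFun hT g y l = _
  have h := relExtFun_mul hT g y hl U.one_mem
  rwa [mul_one, show (⟨1, U.one_mem⟩ : U) = 1 from rfl, one_smul] at h

/-- As `l u ⊗ y = l ⊗ u y`, the elements `l ⊗ y` with `l ∈ L` generate `A ⊗_U Y`. On them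
`relExtMap` and `extMap` are both given by the obvious formula. -/
theorem extension_hom_ext (hT : IsTwistedProduct S L U) {X : Type*} [AddCommGroup X]
    [Module S X] {f g : extension U Y →ₗ[S] X}
    (h : ∀ l ∈ L, ∀ y, f (extMk U l y) = g (extMk U l y)) : f = g := by
  ext x
  induction x using extension_induction with
  | zero => simp
  | mk a y =>
    induction a using hT.induction with
    | zero => rw [extMk_zero, map_zero, map_zero]
    | mul l hl u hu => rw [← extMk_smul l ⟨u, hu⟩ y, h l hl]
    | add a b ha hb => rw [extMk_add, map_add, map_add, ha, hb]
  | add x y hx hy => rw [map_add, map_add, hx, hy]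

/-- Extension of scalars preserves short exact sequences of `U`-modules that split over `S`. -/
def relSplitSeqExtension (i : Y →ₗ[U] Z) (p : Z →ₗ[U] W) (r : Z →ₗ[relSubring S U] Y)
    (s : W →ₗ[relSubring S U] Z) (hri : ∀ y, r (i y) = y) (hps : ∀ w, p (s w) = w)
    (h : ∀ z, i (r z) + s (p z) = z) :
    RelSplitSeq S (extension U Y) (extension U Z) (extension U W) where
  i := extMap i
  p := extMap p
  r := relExtMap hT r
  s := relExtMap hT s
  r_i := extension_hom_ext hT fun l hl y => by
    simp only [LinearMap.comp_apply, LinearMap.restrictScalars_apply, extMap_mk,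
      relExtMap_mk hT _ hl, hri, LinearMap.id_apply]
  p_s := extension_hom_ext hT fun l hl y => by
    simp only [LinearMap.comp_apply, LinearMap.restrictScalars_apply, extMap_mk,
      relExtMap_mk hT _ hl, hps, LinearMap.id_apply]
  i_r_add_s_p := extension_hom_ext hT fun l hl y => by
    simp only [LinearMap.add_apply, LinearMap.comp_apply, LinearMap.restrictScalars_apply,
      extMap_mk, relExtMap_mk hT _ hl, ← map_add, h, LinearMap.id_apply]

end Extension

section Vanishing

variable {A : Type u} [Ring A] {S L U : Subring A}

/-! ### The relatively free module `U ⊗_S Y` -/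

section Free

variable (S) (U) (Y : Type u) [AddCommGroup Y] [Module U Y]

/-- The left `U`-module `U ⊗_S Y`. -/
abbrev relFree : Type u := RingTensor (relSubring S U) U Y

variable {Y}

/-- The multiplication `U ⊗_S Y → Y`. -/
def relFreeAct : relFree S U Y →ₗ[U] Y :=
  RingTensor.liftLeft (T := U)
    (AddMonoidHom.mk' (fun u => AddMonoidHom.mk' (fun y : Y => u • y) (smul_add u))
      (fun u v => by ext y; exact add_smul u v y))
    (fun u s y => mul_smul u (s : U) y)
    (fun u v y => mul_smul u v y)

/-- The `S`-linear section `y ↦ 1 ⊗ y` of the multiplication. -/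
def relFreeSection : Y →ₗ[relSubring S U] relFree S U Y where
  toFun y := RingTensor.tmul (relSubring S U) 1 y
  map_add' := RingTensor.tmul_add 1
  map_smul' s y := by
    rw [← RingTensor.smul_tmul]
    change RingTensor.tmul _ (1 * (s : U)) y = RingTensor.tmul _ ((s : U) * 1) y
    rw [one_mul, mul_one]

theorem relFreeAct_relFreeSection (y : Y) : relFreeAct S U (relFreeSection S U y) = y :=
  one_smul U y

theorem smul_relFreeSection (u : U) (y : Y) :
    u • relFreeSection S U y = RingTensor.tmul (relSubring S U) u y := by
  change RingTensor.tmul _ (u * 1) y = _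
  rw [mul_one]

/-- If `U` is upper triangular and `e` is the identity on `Y`, so it is on `U ⊗_S Y`. -/
theorem smul_relFree_eq_self {e : A} (heS : e ∈ S) (heU : e ∈ U) (hU : IsUpperTriangular e U)
    (hY : ∀ y : Y, (⟨e, heU⟩ : U) • y = y) (z : relFree S U Y) : (⟨e, heU⟩ : U) • z = z := by
  induction z using RingTensor.induction_on with
  | zero => rw [smul_zero]
  | tmul u y =>
    have hy : (⟨⟨e, heU⟩, heS⟩ : relSubring S U) • y = y := hY y
    have h : RingTensor.tmul (relSubring S U) (u * ⟨e, heU⟩) y = RingTensor.tmul _ u y := by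
      have := RingTensor.smul_tmul u (⟨⟨e, heU⟩, heS⟩ : relSubring S U) y
      rwa [hy] at this
    -- Since `u ⊗ y = u ⊗ e y = u e ⊗ y`, only `e u e = u e` is needed, which is upper
    -- triangularity.
    have hu : (⟨e, heU⟩ : U) * (u * ⟨e, heU⟩) = u * ⟨e, heU⟩ := by
      ext
      have := hU u u.2
      rw [sub_mul, one_mul, sub_mul, sub_eq_zero] at this
      change e * ((u : A) * e) = u * e
      rw [← mul_assoc, ← this]
    rw [← h, RingTensor.left_smul_tmul, smul_eq_mul, hu]
  | add x y hx hy => rw [smul_add, hx, hy]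

/-- The pure tensor `a ⊗ x` in `A ⊗_S X`. -/
def barStepMk (X : RingBimodule.{u, 0, u} A ℤ) (a : A) : X →+ barStep S X :=
  AddMonoidHom.mk' (fun x => (RingTensor.tmul S a x : RingTensor S A X)) (RingTensor.tmul_add a)

variable {X : RingBimodule.{u, 0, u} A ℤ}

theorem barStepMk_add (a b : A) (x : X) :
    barStepMk S X (a + b) x = barStepMk S X a x + barStepMk S X b x :=
  RingTensor.add_tmul a b x

theorem barStepMk_mul (a : A) (s : S) (x : X) :
    barStepMk S X (a * s) x = barStepMk S X a ((s : A) • x) :=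
  RingTensor.smul_tmul (R := S) (N := A) (M := X) a s x

theorem barAct_barStepMk (a : A) (x : X) : barAct S X (barStepMk S X a x) = a • x := rfl

/-- The map `U ⊗_S Y → A ⊗_S (A ⊗_U (U ⊗_S Y))`, `u ⊗ y ↦ u ⊗ (1 ⊗ (1 ⊗ y))`. -/
def relFreeSplitAux : relFree S U Y →+ barStep S (extension U (relFree S U Y)) :=
  RingTensor.lift
    (AddMonoidHom.mk' (fun u : U => (barStepMk S (extension U (relFree S U Y)) (u : A)).comp
      ((extMk U 1).comp (relFreeSection S U).toAddMonoidHom))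
      (fun u v => by ext y; exact barStepMk_add S (u : A) v _))
    (fun u s y => by
      change barStepMk S (extension U (relFree S U Y)) ((u : A) * ((s : U) : A))
          (extMk U 1 (relFreeSection S U y)) =
        barStepMk S (extension U (relFree S U Y)) (u : A) (extMk U 1 (relFreeSection S U (s • y)))
      rw [map_smul]
      refine (barStepMk_mul S (u : A) ⟨_, s.2⟩ _).trans (congrArg _ ?_)
      refine (smul_extMk _ _ _).trans (Eq.trans ?_ (extMk_smul 1 (s : U) _).symm)
      rw [one_mul, mul_one]
      rfl)

/-- `A ⊗_U (U ⊗_S Y)` is `A ⊗_S Y`, hence relatively projective: the multiplication is split by the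
`A`-linear extension of `relFreeSplitAux`. -/
theorem isTensorAcyclic_extension_relFree (N : Type*) [AddCommGroup N] [Module Aᵐᵒᵖ N] (k : ℕ) :
    IsTensorAcyclic S N (extension U (relFree S U Y)) k := by
  refine isTensorAcyclic_of_section S N (extLift (relFreeSplitAux S U) ?_) ?_ k
  · intro u z
    induction z using RingTensor.induction_on with
    | zero => simp
    | tmul v y => rfl
    | add x y hx hy => rw [smul_add, map_add, map_add, hx, hy, smul_add]
  · intro x
    induction x using extension_induction with
    | zero => simp
    | mk a z =>
      rw [extLift_mk, map_smul]
      induction z using RingTensor.induction_on with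
      | zero => simp
      | tmul u y =>
        have h : barAct S (extension U (relFree S U Y))
            (relFreeSplitAux S U (RingTensor.tmul (relSubring S U) u y)) =
            (u : A) • extMk U 1 (relFreeSection S U y) := barAct_barStepMk S _ _
        rw [h, ← smul_relFreeSection, extMk_smul, smul_extMk, smul_extMk, mul_one]
      | add x y hx hy => simp only [map_add, smul_add, hx, hy]
    | add x y hx hy => rw [map_add, map_add, hx, hy]

/-- `A ⊗_U U` is relatively projective. -/
theorem isTensorAcyclic_extension_self (N : Type*) [AddCommGroup N] [Module Aᵐᵒᵖ N] (k : ℕ) :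
    IsTensorAcyclic S N (extension U U) k := by
  -- The section is `a ⊗ u ↦ a u ⊗ (1 ⊗ 1)`.
  refine isTensorAcyclic_of_section S N (extLift (AddMonoidHom.mk'
    (fun u : U => barStepMk S (extension U U) (u : A) (extMk U 1 (1 : U)))
    (fun u v => barStepMk_add S (u : A) v _)) (fun u v => rfl)) ?_ k
  intro x
  induction x using extension_induction with
  | zero => simp
  | mk a u =>
    have h := extMk_smul (U := U) a u (1 : U)
    rw [smul_eq_mul, mul_one] at h
    change barAct S _ (a • barStepMk S (extension U U) (u : A) (extMk U 1 (1 : U))) = _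
    rw [map_smul, barAct_barStepMk, smul_extMk, smul_extMk,
      mul_one, h]
  | add x y hx hy => rw [map_add, map_add, hx, hy]

end Free

/-! ### Vanishing for extended modules -/

/-- The `S`-linear retraction of `Z` onto the kernel of `p` given by a section `s` of `p`. -/
def kerRetraction {Y Z : Type*} [AddCommGroup Y] [Module U Y] [AddCommGroup Z] [Module U Z]
    (p : Z →ₗ[U] Y) (s : Y →ₗ[relSubring S U] Z) (hps : ∀ y, p (s y) = y) :
    Z →ₗ[relSubring S U] LinearMap.ker p where
  toFun z := ⟨z - s (p z), by rw [LinearMap.mem_ker, map_sub, hps, sub_self]⟩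
  map_add' x y := by ext; simp only [map_add, Submodule.coe_add]; abel
  map_smul' a x := by
    ext
    have h : p (a • x) = a • p x := map_smul p (a : U) x
    change a • x - s (p (a • x)) = a • (x - s (p x))
    rw [h, map_smul, smul_sub]

/-- Extension of scalars applied to an `S`-split surjection and its kernel. -/
def relSplitSeqOfSection (hT : IsTwistedProduct S L U)
    {Y Z : Type u} [AddCommGroup Y] [Module U Y] [AddCommGroup Z] [Module U Z]
    (p : Z →ₗ[U] Y) (s : Y →ₗ[relSubring S U] Z) (hps : ∀ y, p (s y) = y) :
    RelSplitSeq S (extension U (LinearMap.ker p)) (extension U Z) (extension U Y) :=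
  relSplitSeqExtension hT (LinearMap.ker p).subtype p (kerRetraction p s hps) s
    (fun y => Subtype.ext <| by
      change (y : Z) - s (p y) = y
      rw [LinearMap.mem_ker.1 y.2, map_zero, sub_zero])
    hps (fun z => sub_add_cancel z (s (p z)))

variable {e : A} (N : Type*) [AddCommGroup N] [Module Aᵐᵒᵖ N]

/-- If `N e = 0` and `e` is the identity on `Y`, the relative Tor groups of `N` and `A ⊗_U Y`
vanish in all degrees. -/
theorem isTensorAcyclic_extension (hT : IsTwistedProduct S L U) (heS : e ∈ S)
    (hU : IsUpperTriangular e U) (hN : ∀ n : N, op e • n = 0) (k : ℕ) :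
    ∀ (Y : Type u) [AddCommGroup Y] [Module U Y],
      (∀ y : Y, (⟨e, hT.le_right heS⟩ : U) • y = y) → IsTensorAcyclic S N (extension U Y) k := by
  induction k with
  | zero =>
    intro Y _ _ hY
    have := subsingleton_tensor_extension N (hT.le_right heS) hN
      (smul_relFree_eq_self S U heS (hT.le_right heS) hU hY)
    exact (relSplitSeqOfSection hT (relFreeAct S U) (relFreeSection S U)
      (relFreeAct_relFreeSection S U)).isTensorAcyclic_zero N
      (isTensorAcyclic_extension_relFree S U N 0)
  | succ k ih =>
    intro Y _ _ hY
    -- The kernel of `U ⊗_S Y → Y` inherits the identity action of `e`, so the induction hypothesis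
    -- applies to it.
    have hK (z : LinearMap.ker (relFreeAct S U (Y := Y))) :
        (⟨e, hT.le_right heS⟩ : U) • z = z :=
      Subtype.ext (smul_relFree_eq_self S U heS (hT.le_right heS) hU hY z)
    have := subsingleton_tensor_extension N (hT.le_right heS) hN hK
    exact (relSplitSeqOfSection hT (relFreeAct S U) (relFreeSection S U)
      (relFreeAct_relFreeSection S U)).isTensorAcyclic_succ N
      (isTensorAcyclic_extension_relFree S U N (k + 1)) (ih _ hK)

/-- The left ideal `eU` of an upper triangular subring `U`. -/
def cornerIdeal (heU : e ∈ U) (hU : IsUpperTriangular e U) : Submodule U U where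
  carrier := {u | (⟨e, heU⟩ : U) * u = u}
  add_mem' {x y} hx hy := by
    change _ * (x + y) = x + y
    rw [mul_add, hx, hy]
  zero_mem' := mul_zero _
  smul_mem' c x hx := by
    have hx' : e * (x : A) = x := congrArg Subtype.val hx
    -- Upper triangularity reads `c e = e c e`; with `x = e x` this gives `e c x = e c e x = c e x =
    -- c x`.
    have hc := hU c c.2
    rw [sub_mul, one_mul, sub_mul, sub_eq_zero] at hc
    refine Subtype.ext ?_
    change e * ((c : A) * (x : A)) = (c : A) * x
    rw [← hx', ← mul_assoc (c : A), ← mul_assoc e, ← mul_assoc e, ← hc]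

theorem mul_eq_self_of_mem_cornerIdeal (heU : e ∈ U) (hU : IsUpperTriangular e U) {u : U}
    (hu : u ∈ cornerIdeal heU hU) : (⟨e, heU⟩ : U) * u = u := hu

/-- The `S`-linear map `U/eU → U`, `u ↦ u - e u`. -/
def cornerSection (hS : IsDiagonal e S) (heU : e ∈ U) (hU : IsUpperTriangular e U) :
    (U ⧸ cornerIdeal heU hU) →ₗ[relSubring S U] U :=
  ((((cornerIdeal heU hU).restrictScalars (relSubring S U)).liftQ
    { toFun := fun u : U => u - ⟨e, heU⟩ * u
      map_add' := fun x y => by rw [mul_add]; abel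
      map_smul' := fun s x => by
        -- Diagonality makes `e` commute with `S`: `e s = e s e = s e`. This is what makes the
        -- section `S`-linear.
        have h : e * ((s : U) : A) = ((s : U) : A) * e := by
          have h₁ := hS.1 _ s.2
          have h₂ := hS.2 _ s.2
          rw [sub_mul, one_mul, sub_mul, sub_eq_zero] at h₁
          rw [mul_sub, mul_one, sub_eq_zero] at h₂
          exact h₂.trans h₁.symm
        refine Subtype.ext ?_
        change ((s : U) : A) * (x : A) - e * (((s : U) : A) * x) = ((s : U) : A) * ((x : A) - e * x)
        rw [mul_sub, ← mul_assoc e, h, mul_assoc] }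
    (fun u hu => sub_eq_zero.2 (mul_eq_self_of_mem_cornerIdeal heU hU hu).symm)).comp
    (Submodule.Quotient.restrictScalarsEquiv (relSubring S U)
      (cornerIdeal heU hU)).symm.toLinearMap)

theorem mkQ_cornerSection (he : IsIdempotentElem e) (hS : IsDiagonal e S)
    (heU : e ∈ U) (hU : IsUpperTriangular e U) (x : U ⧸ cornerIdeal heU hU) :
    (cornerIdeal heU hU).mkQ (cornerSection hS heU hU x) = x := by
  obtain ⟨u, rfl⟩ := Submodule.mkQ_surjective _ x
  change (cornerIdeal heU hU).mkQ (u - ⟨e, heU⟩ * u) = _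
  rw [map_sub, sub_eq_self, Submodule.mkQ_apply, Submodule.Quotient.mk_eq_zero]
  refine Subtype.ext ?_
  change e * (e * (u : A)) = e * u
  rw [← mul_assoc, he.eq]

/-- Dimension shifting along `eU → U → U/eU`: the middle term extends to a relatively projective
module, and `e` is the identity on the kernel `eU`. -/
theorem isTensorAcyclic_extension_corner (he : IsIdempotentElem e) (heS : e ∈ S)
    (hS : IsDiagonal e S) (hT : IsTwistedProduct S L U) (hU : IsUpperTriangular e U)
    (hN : ∀ n : N, op e • n = 0) (k : ℕ) :
    IsTensorAcyclic S N (extension U (U ⧸ cornerIdeal (hT.le_right heS) hU)) (k + 1) := by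
  have hK (z : LinearMap.ker (cornerIdeal (hT.le_right heS) hU).mkQ) :
      (⟨e, hT.le_right heS⟩ : U) • z = z := by
    have hz : (z : U) ∈ cornerIdeal (hT.le_right heS) hU :=
      (Submodule.Quotient.mk_eq_zero _).1 (LinearMap.mem_ker.1 z.2)
    exact Subtype.ext (mul_eq_self_of_mem_cornerIdeal _ hU hz)
  have := subsingleton_tensor_extension N (hT.le_right heS) hN hK
  exact (relSplitSeqOfSection hT (cornerIdeal (hT.le_right heS) hU).mkQ
    (cornerSection hS (hT.le_right heS) hU)
    (mkQ_cornerSection he hS (hT.le_right heS) hU)).isTensorAcyclic_succ N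
    (isTensorAcyclic_extension_self S U N (k + 1))
    (isTensorAcyclic_extension N hT heS hU hN k _ hK)

/-! ### The module `A/AeA` -/

/-- `A ⊗_U (U/eU) → A/AeA`, `a ⊗ u ↦ a u`. -/
def cornerToQuotient (heU : e ∈ U) (hU : IsUpperTriangular e U) :
    extension U (U ⧸ cornerIdeal heU hU) →ₗ[A] A ⧸ idempotentIdeal e :=
  extLift (QuotientAddGroup.lift _
      ((Ideal.Quotient.mk (idempotentIdeal e)).toAddMonoidHom.comp U.subtype.toAddMonoidHom)
      (fun u hu => Ideal.Quotient.eq_zero_iff_mem.2 (Ideal.subset_span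
        ⟨1, u, by
          rw [one_mul]
          exact (congrArg Subtype.val (mul_eq_self_of_mem_cornerIdeal heU hU hu)).symm⟩)))
    (fun u y => by
      obtain ⟨v, rfl⟩ := Submodule.mkQ_surjective _ y
      rfl)

/-- `A/AeA → A ⊗_U (U/eU)`, `a ↦ a ⊗ 1`. -/
def quotientToCorner (he : IsIdempotentElem e) (heS : e ∈ S) (hLU : IsLUDecomposition S e L U) :
    A ⧸ idempotentIdeal e →ₗ[A]
      extension U (U ⧸ cornerIdeal (hLU.twisted.le_right heS) hLU.upper) :=
  Submodule.liftQ _ (LinearMap.toSpanSingleton A _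
    (extMk U 1 ((cornerIdeal (hLU.twisted.le_right heS) hLU.upper).mkQ 1))) <| by
    refine Submodule.span_le.2 ?_
    rintro _ ⟨a, b, rfl⟩
    rw [SetLike.mem_coe, LinearMap.mem_ker, LinearMap.toSpanSingleton_apply, mul_smul,
      smul_extMk, mul_one]
    induction b using hLU.twisted.induction with
    | zero => rw [extMk_zero, smul_zero]
    | mul l hl u hu =>
      have hl' := hLU.lower l hl
      rw [mul_sub, mul_one, sub_eq_zero] at hl'
      have h : (⟨u, hu⟩ : U) • (cornerIdeal (hLU.twisted.le_right heS) hLU.upper).mkQ 1 =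
          (cornerIdeal (hLU.twisted.le_right heS) hLU.upper).mkQ ⟨u, hu⟩ := by
        rw [← map_smul, smul_eq_mul, mul_one]
      have h' : (⟨e, hLU.twisted.le_right heS⟩ : U) •
          (cornerIdeal (hLU.twisted.le_right heS) hLU.upper).mkQ ⟨u, hu⟩ = 0 := by
        rw [← map_smul, Submodule.mkQ_apply, Submodule.Quotient.mk_eq_zero]
        refine Subtype.ext ?_
        change e * (e * u) = e * u
        rw [← mul_assoc, he.eq]
      -- Lower triangularity gives `e l = e l e`, so `e l u ⊗ 1 = e l e ⊗ ū = e l ⊗ e ū`, where `ū`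
      -- is the class of `u` in `U/eU`. Then `e ū = 0`.
      rw [mul_smul, smul_extMk e, ← mul_assoc, hl', ← extMk_smul (e * l * e) ⟨u, hu⟩, h,
        ← extMk_smul (e * l) ⟨e, hLU.twisted.le_right heS⟩, h', map_zero, smul_zero]
    | add x y hx hy => rw [extMk_add, smul_add, hx, hy, add_zero]

/-- Acyclicity passes to retracts, so this one composite suffices for the transfer to `A/AeA`. -/
theorem cornerToQuotient_comp (he : IsIdempotentElem e) (heS : e ∈ S)
    (hLU : IsLUDecomposition S e L U) :
    (cornerToQuotient (hLU.twisted.le_right heS) hLU.upper).comp (quotientToCorner he heS hLU) =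
      LinearMap.id := by
  refine LinearMap.ext fun x => ?_
  obtain ⟨a, rfl⟩ := Submodule.mkQ_surjective _ x
  change (a * 1) • Ideal.Quotient.mk (idempotentIdeal e) ((1 : U) : A) = _
  rw [mul_one]
  change Ideal.Quotient.mk (idempotentIdeal e) (a * 1) = _
  rw [mul_one]
  rfl

theorem op_smul_quotient_eq_zero (n : A ⧸ idempotentIdeal e) : op e • n = 0 := by
  obtain ⟨a, rfl⟩ := Ideal.Quotient.mk_surjective n
  rw [quotient_op_smul]
  exact Ideal.Quotient.eq_zero_iff_mem.2 (Ideal.subset_span ⟨a, 1, (mul_one _).symm⟩)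

theorem isTensorAcyclic_quotient (he : IsIdempotentElem e) (heS : e ∈ S) (hS : IsDiagonal e S)
    (hLU : IsLUDecomposition S e L U) (hN : ∀ n : N, op e • n = 0) (k : ℕ) :
    IsTensorAcyclic S N (leftBimodule A (A ⧸ idempotentIdeal e)) (k + 1) :=
  (isTensorAcyclic_extension_corner N he heS hS hLU.twisted hLU.upper hN k).of_retract
    (X := leftBimodule A (A ⧸ idempotentIdeal e)) S N
    (quotientToCorner he heS hLU) (cornerToQuotient _ _) (cornerToQuotient_comp he heS hLU)

end Vanishing

/-! ### Comparison with the relative Tor complex -/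

section Comparison

variable {A : Type u} [Ring A] (S : Subring A) (M : Type u) [AddCommGroup M] [Module A M]

/-- Right multiplication `A → M`, `a ↦ a m`. -/
def regularToLeft (m : M) : regularBimodule A →ₗ[A] leftBimodule A M :=
  LinearMap.toSpanSingleton A M m

variable {M}

/-- The map `B_k(A,S,A) → B_k(A,S,M)`, `x ↦ x m`. -/
def barEval (k : ℕ) (m : M) :
    bar S (regularBimodule A) k →ₗ[S] bar S (leftBimodule A M) k :=
  barMap S ((regularToLeft M m).restrictScalars S) k

theorem barEval_succ_mk (k : ℕ) (m : M) (a : A) (x : bar S (regularBimodule A) k) :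
    barEval S (k + 1) m (barMk S (regularBimodule A) k a x) =
      barMk S (leftBimodule A M) k a (barEval S k m x) := rfl

theorem barEval_smul (k : ℕ) (m : M) (a : A) (x : bar S (regularBimodule A) k) :
    barEval S k m (a • x) = a • barEval S k m x := barMap_smul S (regularToLeft M m) k a x

theorem barEval_add (k : ℕ) (m m' : M) (x : bar S (regularBimodule A) k) :
    barEval S k (m + m') x = barEval S k m x + barEval S k m' x := by
  have h : (regularToLeft (A := A) M (m + m')).restrictScalars S =
      (regularToLeft M m).restrictScalars S + (regularToLeft M m').restrictScalars S := by
    ext a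
    exact smul_add (show A from a) m m'
  rw [barEval, h, barMap_add]
  rfl

/-- The right action reaches only the innermost factor, where `(x a) m = x (a m)`. This is the
balancing condition for `barTensorTo`. -/
theorem barEval_op_smul (k : ℕ) (m : M) (a : A) (x : bar S (regularBimodule A) k) :
    barEval S k m (op a • x) = barEval S k (a • m) x := by
  induction k with
  | zero => exact mul_smul (show A from x) a m
  | succ k ih =>
    induction x using bar_induction with
    | zero => simp
    | mk b y => rw [bar_op_smul_mk, barEval_succ_mk, barEval_succ_mk, ih]
    | add x y hx hy => rw [smul_add, map_add, map_add, hx, hy]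

variable (M)

/-- The map `B_k(A,S,A) ⊗_A M → B_k(A,S,M)`. -/
def barTensorTo (k : ℕ) :
    RingTensor A (bar S (regularBimodule A) k) M →ₗ[A] bar S (leftBimodule A M) k :=
  RingTensor.liftLeft (T := A)
    (AddMonoidHom.mk' (fun x => AddMonoidHom.mk' (fun m => barEval S k m x)
      (fun m m' => barEval_add S k m m' x)) (fun x y => by ext m; exact map_add (barEval S k m) x y))
    (fun x a m => barEval_op_smul S k m a x)
    (fun a x m => barEval_smul S k m a x)

theorem barTensorTo_tmul (k : ℕ) (x : bar S (regularBimodule A) k) (m : M) :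
    barTensorTo S M k (RingTensor.tmul A x m) = barEval S k m x := rfl

/-- The differential of `B(A,S,A) ⊗_A M`. -/
def barTensorD (k : ℕ) : RingTensor A (bar S (regularBimodule A) (k + 1)) M →ₗ[A]
    RingTensor A (bar S (regularBimodule A) k) M :=
  RingTensor.mapLeft (T := A) (barDRight S (regularBimodule A) k) LinearMap.id
    (fun a x => map_smul (barD S (regularBimodule A) k) a x)

theorem barTensorTo_barTensorD (k : ℕ)
    (x : RingTensor A (bar S (regularBimodule A) (k + 1)) M) :
    barTensorTo S M k (barTensorD S M k x) =
      barD S (leftBimodule A M) k (barTensorTo S M (k + 1) x) := by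
  induction x using RingTensor.induction_on with
  | zero => simp
  | tmul x m => exact barMap_barD S (regularToLeft M m) k x
  | add x y hx hy => simp only [map_add, hx, hy]

/-- The right `A`-linear map `x ↦ a ⊗ x`. -/
def barMkRight (k : ℕ) (a : A) :
    bar S (regularBimodule A) k →ₗ[Aᵐᵒᵖ] bar S (regularBimodule A) (k + 1) where
  toFun := barMk S (regularBimodule A) k a
  map_add' := map_add _
  map_smul' b x := (bar_op_smul_mk S (regularBimodule A) k a b x).symm

/-- The map `M → A ⊗_A M`, `m ↦ 1 ⊗ m`. -/
def oneTmul : M →ₗ[A] RingTensor A A M where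
  toFun m := RingTensor.tmul A (1 : A) m
  map_add' := RingTensor.tmul_add (1 : A)
  map_smul' a m := by
    refine (RingTensor.smul_tmul (1 : A) a m).symm.trans ?_
    change RingTensor.tmul A (1 * a) m = RingTensor.tmul A (a * 1) m
    rw [one_mul, mul_one]

/-- The map `B_k(A,S,M) → B_k(A,S,A) ⊗_A M`. -/
def barTensorFrom :
    (k : ℕ) → (bar S (leftBimodule A M) k →ₗ[A] RingTensor A (bar S (regularBimodule A) k) M)
  | 0 => oneTmul M
  | k + 1 => RingTensor.liftLeft (R := S) (N := A) (M := bar S (leftBimodule A M) k) (T := A)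
      (AddMonoidHom.mk' (fun a => (RingTensor.map (barMkRight S k a)
          (LinearMap.id : M →ₗ[A] M)).comp (barTensorFrom k).toAddMonoidHom)
        (fun a b => by
          ext x
          change RingTensor.map (barMkRight S k (a + b)) LinearMap.id (barTensorFrom k x) =
            RingTensor.map (barMkRight S k a) LinearMap.id (barTensorFrom k x) +
            RingTensor.map (barMkRight S k b) LinearMap.id (barTensorFrom k x)
          generalize barTensorFrom k x = y
          induction y using RingTensor.induction_on with
          | zero => simp
          | tmul y m =>
            rw [RingTensor.map_tmul, RingTensor.map_tmul, RingTensor.map_tmul,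
              ← RingTensor.add_tmul]
            exact congrArg (RingTensor.tmul A · m) (RingTensor.add_tmul a b y)
          | add x y hx hy => rw [map_add, map_add, map_add, hx, hy]; abel))
      (fun a s x => by
        change RingTensor.map (barMkRight S k (a * (s : A))) LinearMap.id (barTensorFrom k x) =
          RingTensor.map (barMkRight S k a) LinearMap.id (barTensorFrom k ((s : A) • x))
        rw [map_smul]
        generalize barTensorFrom k x = y
        induction y using RingTensor.induction_on with
        | zero => simp
        | tmul y m => exact congrArg (RingTensor.tmul A · m) (RingTensor.smul_tmul a s y)
        | add x y hx hy => rw [smul_add, map_add, map_add, hx, hy])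
      (fun a b x => by
        change RingTensor.map (barMkRight S k (a * b)) LinearMap.id (barTensorFrom k x) =
          a • RingTensor.map (barMkRight S k b) LinearMap.id (barTensorFrom k x)
        generalize barTensorFrom k x = y
        induction y using RingTensor.induction_on with
        | zero => simp
        | tmul y m => rfl
        | add x y hx hy => rw [map_add, map_add, hx, hy, smul_add])

theorem barTensorFrom_succ_mk (k : ℕ) (a : A) (x : bar S (leftBimodule A M) k) :
    barTensorFrom S M (k + 1) (barMk S (leftBimodule A M) k a x) =
      RingTensor.map (barMkRight S k a) LinearMap.id (barTensorFrom S M k x) := rfl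

/-- Together with compatibility of both maps with the differentials, this makes `B(A,S,A) ⊗_A M` a
retract of the complex `B(A,S,M)`, which is enough to transfer exactness. -/
theorem barTensorFrom_barTensorTo (k : ℕ) (x : RingTensor A (bar S (regularBimodule A) k) M) :
    barTensorFrom S M k (barTensorTo S M k x) = x := by
  induction x using RingTensor.induction_on with
  | zero => simp
  | tmul x m =>
    rw [barTensorTo_tmul]
    induction k with
    | zero =>
      change A at x
      refine (RingTensor.smul_tmul (1 : A) x m).symm.trans ?_
      exact congrArg (RingTensor.tmul A · m) (one_mul x)
    | succ k ih =>
      induction x using bar_induction with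
      | zero => rw [map_zero, map_zero, RingTensor.zero_tmul]
      | mk a y => rw [barEval_succ_mk, barTensorFrom_succ_mk, ih]; rfl
      | add x y hx hy => rw [map_add, map_add, hx, hy, RingTensor.add_tmul]
  | add x y hx hy => rw [map_add, map_add, hx, hy]

theorem barTensorFrom_barD (k : ℕ) (x : bar S (leftBimodule A M) (k + 1)) :
    barTensorFrom S M k (barD S (leftBimodule A M) k x) =
      barTensorD S M k (barTensorFrom S M (k + 1) x) := by
  induction k with
  | zero =>
    induction x using bar_induction with
    | zero => simp
    | mk a y =>
      rw [barD_zero_mk, map_smul, barTensorFrom_succ_mk]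
      generalize barTensorFrom S M 0 y = z
      induction z using RingTensor.induction_on with
      | zero => simp
      | tmul z m => exact congrArg (RingTensor.tmul A · m) (barD_zero_mk S _ a z).symm
      | add x y hx hy => rw [smul_add, hx, hy, map_add, map_add]
    | add x y hx hy => simp only [map_add, hx, hy]
  | succ k ih =>
    induction x using bar_induction with
    | zero => simp
    | mk a y =>
      rw [barD_succ_mk, map_sub, map_smul, barTensorFrom_succ_mk, barTensorFrom_succ_mk, ih]
      generalize barTensorFrom S M (k + 1) y = z
      induction z using RingTensor.induction_on with
      | zero => simp
      | tmul z m =>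
        refine Eq.trans ?_ (congrArg (RingTensor.tmul A · m) (barD_succ_mk S _ k a z).symm)
        rw [sub_eq_iff_eq_add]
        refine Eq.trans ?_ (RingTensor.add_tmul (R := A) _ _ m)
        exact congrArg (RingTensor.tmul A · m) (sub_add_cancel _ _).symm
      | add x y hx hy =>
        simp only [smul_add, map_add, ← hx, ← hy]
        abel
    | add x y hx hy => simp only [map_add, hx, hy]

/-! ### Transfer of exactness to the relative Tor groups -/

variable (N : Type*) [AddCommGroup N] [Module Aᵐᵒᵖ N]

/-- Acyclicity of `N ⊗_A B(A,S,M)` gives the exactness of `N ⊗_A B(A,S,A) ⊗_A M`. -/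
theorem exists_relTorD_eq {k : ℕ} (h : IsTensorAcyclic S N (leftBimodule A M) (k + 1))
    (x : relTorObj S N M (k + 1)) (hx : relTorD S N M k x = 0) :
    ∃ y, relTorD S N M (k + 1) y = x := by
  have hD (j : ℕ) : relTorD S N M j = RingTensor.map LinearMap.id (barTensorD S M (j + 1)) := rfl
  -- Degree `k + 1` of the Tor complex is `B_{k+1}`, whose index in `bar` is `k + 2` because `bar`
  -- starts with the augmentation term.
  obtain ⟨y, hy⟩ := h (RingTensor.map LinearMap.id (barTensorTo S M (k + 2)) x) (by
    rw [tensorBarD, RingTensor.map_id_map_id,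
      show barD S (leftBimodule A M) (k + 1) ∘ₗ barTensorTo S M (k + 2) =
        barTensorTo S M (k + 1) ∘ₗ barTensorD S M (k + 1) from
        LinearMap.ext fun x => (barTensorTo_barTensorD S M (k + 1) x).symm,
      ← RingTensor.map_id_map_id, ← hD, hx, map_zero])
  refine ⟨RingTensor.map LinearMap.id (barTensorFrom S M (k + 3)) y, ?_⟩
  rw [hD, RingTensor.map_id_map_id,
    show barTensorD S M (k + 2) ∘ₗ barTensorFrom S M (k + 3) =
      barTensorFrom S M (k + 2) ∘ₗ barD S (leftBimodule A M) (k + 2) from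
      LinearMap.ext fun x => (barTensorFrom_barD S M (k + 2) x).symm,
    ← RingTensor.map_id_map_id]
  rw [tensorBarD] at hy
  rw [hy, RingTensor.map_id_map_id,
    show barTensorFrom S M (k + 2) ∘ₗ barTensorTo S M (k + 2) = LinearMap.id from
      LinearMap.ext fun x => barTensorFrom_barTensorTo S M (k + 2) x,
    RingTensor.map_id_id]

theorem isZero_relTor {k : ℕ} (h : IsTensorAcyclic S N (leftBimodule A M) (k + 1)) :
    Limits.IsZero (relTor S N M (k + 1)) := by
  rw [relTor, ← HomologicalComplex.exactAt_iff_isZero_homology,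
    HomologicalComplex.exactAt_iff' _ (k + 2) (k + 1) k (by simp) (by simp),
    ShortComplex.ab_exact_iff]
  intro x hx
  have h₁ : (relTorComplex S N M).d (k + 1) k = AddCommGrpCat.ofHom (relTorD S N M k) :=
    ChainComplex.of_d (fun k => AddCommGrpCat.of (relTorObj S N M k))
      (fun k => AddCommGrpCat.ofHom (relTorD S N M k)) k
  have h₂ : (relTorComplex S N M).d (k + 2) (k + 1) =
      AddCommGrpCat.ofHom (relTorD S N M (k + 1)) :=
    ChainComplex.of_d (fun k => AddCommGrpCat.of (relTorObj S N M k))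
      (fun k => AddCommGrpCat.ofHom (relTorD S N M k)) (k + 1)
  obtain ⟨y, hy⟩ := exists_relTorD_eq S M N h x (by
    change (relTorComplex S N M).d (k + 1) k x = 0 at hx
    rw [h₁] at hx
    exact hx)
  refine ⟨y, ?_⟩
  change (relTorComplex S N M).d (k + 2) (k + 1) y = x
  rw [h₂]
  exact hy

end Comparison

end

/-! ### The stratification theorem -/

theorem mainTheorem1 {A : Type u} [Ring A] (S : Subring A) (e : A) (heS : e ∈ S)
    (he : IsIdempotentElem e) (hS : IsDiagonal e S) (L U : Subring A)
    (hLU : IsLUDecomposition S e L U) : IsRelStratifying S e := by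
  intro k hk
  obtain ⟨k, rfl⟩ := Nat.exists_eq_add_of_le' hk
  exact isZero_relTor S _ _
    (isTensorAcyclic_quotient _ he heS hS hLU op_smul_quotient_eq_zero k)
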